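/- Let $N\ge 1$, let $E\in C^3(\mathbb R^N)$, let $L>0$, and let $\Omega\subset\mathbb R^N$ be a connected component of the closed set $\{x\in\mathbb R^N : \|\nabla E(x)\|\le L\}$ which is bounded (hence compact). Let $\lambda_1(x)\le\lambda_2(x)\le\dots\le\lambda_N(x)$ be the eigenvalues of $\nabla^2E(x)$, counted with multiplicity, and suppose that $\lambda_1(x)<0<\lambda_2(x)$ for all $x\in\Omega$ (only $\lambda_1(x)<0$ if $N=1$). For $x \in \Omega$ denote by $v_1(x)$ a unit eigenvector of $\nabla^2E(x)$ for $\lambda_1(x)$; it is determined up to sign. An index-1 saddle is a point $x_*$ with $\nabla E(x_*)=0$ and $\lambda_1(x_*)<0<\lambda_2(x_*)$. Let $S_1$ be the unit sphere of $\mathbb R^N$ and $(v\otimes v)w=\langle v,w\rangle v$. Then there are $\varepsilon_0,\delta_0>0$ such that for all $0<\varepsilon<\varepsilon_0$ and $0<\delta<\delta_0$ the following holds. For every $x_0\in\operatorname{int}(\Omega)$, either choice of sign of $v_1(x_0)$, and every $v_0\in S_1$ with $\|v_0-v_1(x_0)\|<\delta$, the gentlest ascent dynamics $$\dot x=-(I-2\,v\otimes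 v)\nabla E(x),\qquad \varepsilon^2\dot v=-(I-v\otimes v)\nabla^2E(x)\,v,\qquad x(0)=x_0,\ v(0)=v_0,$$ has a unique solution on $[0,\infty)$, and this solution satisfies $(x,v)\in C^1([0,\infty);\Omega\times S_1)$. Moreover, there exist an index-1 saddle $x_*\in\Omega$ and constants $K,c>0$ such that $$\|x(t)-x_*\|+\|v(t)-v_1(x_*)\|\le K e^{-ct}\qquad\text{for all } t\ge0,$$ where the sign of $v_1(x_*)$ is the one obtained from that of $v_1(x_0)$ by continuity: there is a continuous choice of $v_1(x(t))$, $t\ge0$, which starts at the given $v_1(x_0)$ and converges to $v_1(x_*)$ as $t\to\infty$. -/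

import Mathlib

open Set Filter Topology

noncomputable section

namespace SaddleSearch

/-- The Hessian `∇²E(x)`, as a linear operator: the derivative of the gradient at `x`. -/
def hessian {N : ℕ} (E : EuclideanSpace ℝ (Fin N) → ℝ) (x : EuclideanSpace ℝ (Fin N)) :
    EuclideanSpace ℝ (Fin N) →L[ℝ] EuclideanSpace ℝ (Fin N) :=
  fderiv ℝ (gradient E) x

/-- The eigenvalues of a symmetric operator on `ℝ^N`, counted with multiplicity and listed in
nondecreasing order (Mathlib lists them in nonincreasing order, hence `Fin.rev`). The index starts
at `0`, so that `λ₁` is `eig hT 0`. -/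
def eig {N : ℕ} {T : EuclideanSpace ℝ (Fin N) →ₗ[ℝ] EuclideanSpace ℝ (Fin N)}
    (hT : T.IsSymmetric) (i : Fin N) : ℝ :=
  hT.eigenvalues finrank_euclideanSpace_fin i.rev

/-- `λ₁(x) < 0 < λ₂(x) ≤ ⋯ ≤ λ_N(x)` for the eigenvalues of `∇²E(x)`
(which means `λ₁(x) < 0` if `N = 1`). -/
def HasIndexOne {N : ℕ} [NeZero N] (E : EuclideanSpace ℝ (Fin N) → ℝ)
    (x : EuclideanSpace ℝ (Fin N)) : Prop :=
  ∃ hH : (hessian E x : EuclideanSpace ℝ (Fin N) →ₗ[ℝ] EuclideanSpace ℝ (Fin N)).IsSymmetric,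
    eig hH 0 < 0 ∧ ∀ i : Fin N, i ≠ 0 → 0 < eig hH i

/-- `u` is a normalized eigenvector for the smallest eigenvalue `λ₁(x)` of `∇²E(x)`, that is,
`u = v₁(x)` for one of the two choices of sign if `λ₁(x)` is simple. -/
def IsLowestEigenvector {N : ℕ} [NeZero N] (E : EuclideanSpace ℝ (Fin N) → ℝ)
    (x u : EuclideanSpace ℝ (Fin N)) : Prop :=
  ‖u‖ = 1 ∧
    ∃ hH : (hessian E x : EuclideanSpace ℝ (Fin N) →ₗ[ℝ] EuclideanSpace ℝ (Fin N)).IsSymmetric,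
      hessian E x u = eig hH 0 • u

/-- A (nondegenerate) index-1 saddle of `E`. -/
def IsIndexOneSaddle {N : ℕ} [NeZero N] (E : EuclideanSpace ℝ (Fin N) → ℝ)
    (x : EuclideanSpace ℝ (Fin N)) : Prop :=
  gradient E x = 0 ∧ HasIndexOne E x

/-- `(x, v)` is a solution on `[0, ∞)` of the gentlest ascent dynamics
`x' = -(I - 2 v ⊗ v) ∇E(x)`, `ε² v' = -(I - v ⊗ v) ∇²E(x) v` with `x(0) = x₀`, `v(0) = v₀`.
Values of `x` and `v` at negative times play no role. -/
structure IsGADSolution {N : ℕ} (E : EuclideanSpace ℝ (Fin N) → ℝ) (ε : ℝ)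
    (x₀ v₀ : EuclideanSpace ℝ (Fin N)) (x v : ℝ → EuclideanSpace ℝ (Fin N)) : Prop where
  x_zero : x 0 = x₀
  v_zero : v 0 = v₀
  x_deriv : ∀ t, 0 ≤ t → HasDerivWithinAt x
    (-(gradient E (x t) - (2 * inner ℝ (v t) (gradient E (x t))) • v t)) (Ici 0) t
  v_deriv : ∀ t, 0 ≤ t → HasDerivWithinAt v
    (-((ε ^ 2)⁻¹ • (hessian E (x t) (v t) - inner ℝ (v t) (hessian E (x t) (v t)) • v t)))
    (Ici 0) t

end SaddleSearch

end

/-! Write H = ∇²E(x), R = ⟨v, Hv⟩ and r = Hv - Rv. Alignment of v is measured by the residual r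
instead of the distance to v₁(x), so no eigenvector is ever differentiated. Compactness of Ω gives μ
> 0 with λ₁ ≤ -μ and all other eigenvalues ≥ μ on Ω. If R ≤ 0 and ‖r‖ ≤ η with η small, then R ≤
-μ/2 and H ≥ μ/2 on the orthogonal complement of v (`HasGap.coercive_of_residual_le`).

Two estimates follow. In ⟨∇E, H(I - 2 v ⊗ v)∇E⟩ the mixed terms cancel, so ‖∇E‖² decays at rate μ.
And ‖r‖² is damped at rate μ/ε², up to an error 2B‖∇E‖‖r‖ caused by the motion of x, where B bounds
the derivative of H. By Young's inequality, for small ε the function a‖∇E‖² + ‖r‖² decays at rate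
μ/2 (`HasUniformBounds.exists_deriv_lyapunov`).

A continuity argument (`mem_of_closed_open_bootstrap`) shows that alignment is never lost: ‖∇E‖
starts strictly below L, because ∇E is open at points of the interior, and does not grow; ‖r‖ stays
below η; R cannot reach 0, since R ≤ 0 already forces R ≤ -μ/2; and x stays in Ω because its path is
connected. The velocity is bounded by a multiple of the square root of the Lyapunov function, so the
trajectory converges exponentially, to a point with ∇E = 0 and r = 0. Since v stays within 1/4 of
one of the vectors ±v₁(x), it singles out a continuous choice of sign. -/

namespace SaddleSearch

/-! ### Ordinary differential equations -/

section ODE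

open scoped NNReal

variable {F : Type*} [NormedAddCommGroup F] [NormedSpace ℝ F]

/-- Solutions of an autonomous ODE on `[0, ∞)` with a `C¹` right-hand side are unique. -/
theorem eq_of_hasDerivWithinAt_Ici [FiniteDimensional ℝ F] {G : F → F} (hG : ContDiff ℝ 1 G)
    {y z : ℝ → F} (hy : ∀ t, 0 ≤ t → HasDerivWithinAt y (G (y t)) (Ici 0) t)
    (hz : ∀ t, 0 ≤ t → HasDerivWithinAt z (G (z t)) (Ici 0) t) (h0 : y 0 = z 0) {t : ℝ}
    (ht : 0 ≤ t) : y t = z t := by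
  have hcont : ∀ {w : ℝ → F}, (∀ t, 0 ≤ t → HasDerivWithinAt w (G (w t)) (Ici 0) t) →
      ContinuousOn w (Icc 0 t) := fun hw s hs =>
    ((hw s hs.1).continuousWithinAt).mono Icc_subset_Ici_self
  have hK : IsCompact (y '' Icc 0 t ∪ z '' Icc 0 t) :=
    (isCompact_Icc.image_of_continuousOn (hcont hy)).union
      (isCompact_Icc.image_of_continuousOn (hcont hz))
  obtain ⟨K, hKG⟩ :=
    (hG.locallyLipschitz.locallyLipschitzOn).exists_lipschitzOnWith_of_compact hK
  refine ODE_solution_unique_of_mem_Icc_right (v := fun _ => G)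
    (s := fun _ => y '' Icc 0 t ∪ z '' Icc 0 t) (K := K) (fun _ _ => hKG) (hcont hy)
    (fun s hs => (hy s hs.1).mono (Ici_subset_Ici.2 hs.1))
    (fun s hs => Or.inl ⟨s, ⟨hs.1, hs.2.le⟩, rfl⟩) (hcont hz)
    (fun s hs => (hz s hs.1).mono (Ici_subset_Ici.2 hs.1))
    (fun s hs => Or.inr ⟨s, ⟨hs.1, hs.2.le⟩, rfl⟩) h0 ⟨ht, le_rfl⟩

/-- A bounded Lipschitz vector field has a global integral curve through every point. -/
theorem exists_hasDerivAt_of_lipschitzWith [CompleteSpace F] {G : F → F} {K : ℝ≥0}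
    (hG : LipschitzWith K G) {C : ℝ≥0} (hC : ∀ z, ‖G z‖ ≤ C) (z₀ : F) :
    ∃ z : ℝ → F, z 0 = z₀ ∧ ∀ t, HasDerivAt z (G (z t)) t := by
  have hloc : ∀ n : ℕ, ∃ z : ℝ → F, z 0 = z₀ ∧
      ∀ t ∈ Ioo (-(n + 1 : ℝ)) (n + 1), HasDerivAt z (G (z t)) t := by
    intro n
    have h0 : (0 : ℝ) ∈ Icc (-(n + 1 : ℝ)) (n + 1) := by
      constructor <;> [(have := n.cast_nonneg (α := ℝ); linarith); positivity]
    -- A field bounded by C moves a point by at most C(n + 1) in time n + 1, so this radius allows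
    -- any interval length.
    have hPL : IsPicardLindelof (fun _ => G) (⟨0, h0⟩ : Icc (-(n + 1 : ℝ)) (n + 1)) z₀
        (C * (n + 1)) 0 C K :=
      { lipschitzOnWith := fun _ _ => hG.lipschitzOnWith
        continuousOn := fun _ _ => continuousOn_const
        norm_le := fun _ _ z _ => hC z
        mul_max_le := by simp }
    obtain ⟨z, hz0, hz⟩ := hPL.exists_eq_forall_mem_Icc_hasDerivWithinAt₀
    exact ⟨z, hz0, fun t ht => (hz t (Ioo_subset_Icc_self ht)).hasDerivAt
      (Icc_mem_nhds ht.1 ht.2)⟩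
  choose ζ hζ0 hζ using hloc
  have hagree : ∀ m n : ℕ, m ≤ n → ∀ t ∈ Ioo (-(m + 1 : ℝ)) (m + 1), ζ m t = ζ n t := by
    intro m n hmn
    have hmn' : (m : ℝ) ≤ n := by exact_mod_cast hmn
    have hm : (0 : ℝ) ≤ m := m.cast_nonneg
    exact ODE_solution_unique_of_mem_Ioo (v := fun _ => G) (s := fun _ => univ) (K := K) (t₀ := 0)
      (fun _ _ => hG.lipschitzOnWith) ⟨by linarith, by linarith⟩
      (fun t ht => ⟨hζ m t ht, mem_univ _⟩)
      (fun t ht => ⟨hζ n t ⟨by linarith [ht.1], by linarith [ht.2]⟩, mem_univ _⟩)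
      (by rw [hζ0, hζ0])
  have hagree' : ∀ m n : ℕ, ∀ t : ℝ, |t| < m + 1 → |t| < n + 1 → ζ m t = ζ n t := by
    intro m n t hm hn
    rcases le_total m n with h | h
    · exact hagree m n h t (abs_lt.1 hm)
    · exact (hagree n m h t (abs_lt.1 hn)).symm
  have hceil : ∀ t : ℝ, |t| < (⌈|t|⌉₊ : ℝ) + 1 := fun t =>
    (Nat.le_ceil _).trans_lt (lt_add_one _)
  -- The index ⌈|t|⌉₊ belongs to an interval of half-length ⌈|t|⌉₊ + 1, so t lies in its interior
  -- and the glued curve agrees with one local curve near t.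
  refine ⟨fun t => ζ ⌈|t|⌉₊ t, by simp [hζ0], fun t => ?_⟩
  have hev : (fun s => ζ ⌈|s|⌉₊ s) =ᶠ[𝓝 t] ζ ⌈|t|⌉₊ := by
    have : ∀ᶠ s in 𝓝 t, |s| < (⌈|t|⌉₊ : ℝ) + 1 :=
      continuous_abs.continuousAt.eventually_lt continuousAt_const (hceil t)
    filter_upwards [this] with s hs using hagree' _ _ _ (hceil s) hs
  exact (hζ _ t (abs_lt.1 (hceil t))).congr_of_eventuallyEq hev

/-- A `C¹` vector field agrees on any ball around the origin with one whose integral curves are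
global. -/
theorem exists_global_truncated_curve [FiniteDimensional ℝ F] {G : F → F} (hG : ContDiff ℝ 1 G)
    {ρ : ℝ} (hρ : 0 < ρ) (z₀ : F) :
    ∃ z : ℝ → F, z 0 = z₀ ∧ ContDiff ℝ 1 z ∧ ∀ t, ‖z t‖ ≤ ρ → HasDerivAt z (G (z t)) t := by
  have : CompleteSpace F := FiniteDimensional.complete ℝ F
  -- The cut-off field is C¹ with compact support, hence bounded and globally Lipschitz.
  let χ : ContDiffBump (0 : F) := ⟨ρ, ρ + 1, hρ, by linarith⟩
  have hχ : ContDiff ℝ 1 (fun z => χ z • G z) := χ.contDiff.smul hG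
  have hsupp : HasCompactSupport (fun z => χ z • G z) := χ.hasCompactSupport.smul_right
  obtain ⟨K, hK⟩ := hχ.lipschitzWith_of_hasCompactSupport hsupp one_ne_zero
  obtain ⟨C, hC⟩ := hsupp.exists_bound_of_continuous hχ.continuous
  obtain ⟨z, hz0, hz⟩ := exists_hasDerivAt_of_lipschitzWith hK (C := C.toNNReal)
    (fun z => (hC z).trans (Real.le_coe_toNNReal C)) z₀
  have hzc : Continuous z := continuous_iff_continuousAt.2 fun t => (hz t).continuousAt
  refine ⟨z, hz0, ?_, fun t ht => ?_⟩
  · rw [contDiff_one_iff_deriv]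
    refine ⟨fun t => (hz t).differentiableAt, ?_⟩
    rw [funext fun t => (hz t).deriv]
    exact hχ.continuous.comp hzc
  · have h1 : χ (z t) = 1 := χ.one_of_mem_closedBall (by simpa [χ] using ht)
    simpa [h1] using hz t

/-- Continuity principle: a curve starting in `C` which is in `U` at any time up to which
it did not leave the closed set `C ⊇ U` stays in `U`. -/
theorem mem_of_closed_open_bootstrap {X : Type*} [TopologicalSpace X] {f : ℝ → X}
    (hf : Continuous f) {C U : Set X} (hC : IsClosed C) (hU : IsOpen U) (hUC : U ⊆ C)
    (h0 : f 0 ∈ C) (h : ∀ t, 0 ≤ t → (∀ s ∈ Icc 0 t, f s ∈ C) → f t ∈ U) {t : ℝ} (ht : 0 ≤ t) :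
    f t ∈ U := by
  suffices hs : Icc 0 t ⊆ {s | ∀ r ∈ Icc 0 s, f r ∈ C} from h t ht (hs ⟨ht, le_rfl⟩)
  refine IsClosed.Icc_subset_of_forall_mem_nhdsWithin ?_ ?_ ?_
  · refine IsClosed.inter ?_ isClosed_Icc
    rw [← isOpen_compl_iff, isOpen_iff_mem_nhds]
    intro s hs
    simp only [mem_compl_iff, mem_ofPred_eq, not_forall] at hs
    obtain ⟨r, hr, hrC⟩ := hs
    -- Since the complement of C is open, an exit at time s > 0 is already visible at some r' < s,
    -- hence for all times near s.
    obtain ⟨r', hr', hlt⟩ : ∃ r' ∈ Icc (0 : ℝ) s, f r' ∉ C ∧ (r' < s ∨ s = 0) := by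
      rcases hr.2.lt_or_eq with hlt | rfl
      · exact ⟨r, hr, hrC, Or.inl hlt⟩
      rcases hr.1.lt_or_eq with hpos | rfl
      · have hev : ∀ᶠ q in 𝓝 r, f q ∉ C :=
          hf.continuousAt.eventually_mem (hC.isOpen_compl.mem_nhds hrC)
        have hev' : ∀ᶠ q in 𝓝[<] r, f q ∉ C ∧ q ∈ Ioo 0 r :=
          (hev.filter_mono nhdsWithin_le_nhds).and (Ioo_mem_nhdsLT hpos)
        obtain ⟨q, hq, hq'⟩ := hev'.exists
        exact ⟨q, ⟨hq'.1.le, hq'.2.le⟩, hq, Or.inl hq'.2⟩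
      · exact ⟨0, hr, hrC, Or.inr rfl⟩
    rcases hlt.2 with hlt' | rfl
    · filter_upwards [lt_mem_nhds hlt'] with q hq
      simp only [mem_compl_iff, mem_ofPred_eq, not_forall]
      exact ⟨r', ⟨hr'.1, hq.le⟩, hlt.1⟩
    · exact absurd h0 (by
        have : r' = 0 := le_antisymm hr'.2 hr'.1
        exact this ▸ hlt.1)
  · intro r hr
    have : r = 0 := le_antisymm hr.2 hr.1
    exact this ▸ h0
  · intro s hs
    have hev : ∀ᶠ q in 𝓝 s, f q ∈ U :=
      hf.continuousAt.eventually_mem (hU.mem_nhds (h s hs.2.1 hs.1))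
    obtain ⟨e, he, hball⟩ := Metric.eventually_nhds_iff.1 hev
    have hlt : ∀ᶠ q in 𝓝[>] s, q ∈ Ioo s (s + e) := Ioo_mem_nhdsGT (by linarith)
    filter_upwards [hlt] with q hq r hr
    rcases le_or_gt r s with hrs | hrs
    · exact hs.1 r ⟨hr.1, hrs⟩
    · refine hUC (hball ?_)
      rw [Real.dist_eq, abs_of_pos (by linarith)]
      linarith [hr.2, hq.2]

/-- A curve with exponentially decaying velocity converges exponentially. -/
theorem exists_limit_of_norm_deriv_le_exp [CompleteSpace F] {z z' : ℝ → F} {K c : ℝ} (hc : 0 < c)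
    (hz : ∀ t, 0 ≤ t → HasDerivAt z (z' t) t)
    (hb : ∀ t, 0 ≤ t → ‖z' t‖ ≤ K * Real.exp (-c * t)) :
    ∃ l, ∀ t, 0 ≤ t → ‖z t - l‖ ≤ K / c * Real.exp (-c * t) := by
  have hK : 0 ≤ K := by simpa using (norm_nonneg _).trans (hb 0 le_rfl)
  have key : ∀ s t, 0 ≤ s → s ≤ t → ‖z t - z s‖ ≤ K / c * Real.exp (-c * s) := by
    intro s t hs hst
    have hB : ∀ r, HasDerivAt (fun r => K / c * (Real.exp (-c * s) - Real.exp (-c * r)))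
        (K * Real.exp (-c * r)) r := by
      intro r
      have h1 : HasDerivAt (fun r => Real.exp (-c * r)) (Real.exp (-c * r) * (-c * 1)) r :=
        ((hasDerivAt_id r).const_mul (-c)).exp
      convert! (h1.const_sub (Real.exp (-c * s))).const_mul (K / c) using 1
      field_simp
    have h := image_norm_le_of_norm_deriv_right_le_deriv_boundary (a := s) (b := t)
      (f := fun r => z r - z s) (f' := z')
      (fun r hr => (((hz r (hs.trans hr.1)).sub_const _).continuousAt).continuousWithinAt)
      (fun r hr => ((hz r (hs.trans hr.1)).sub_const _).hasDerivWithinAt) (by simp) hB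
      (fun r hr => hb r (hs.trans hr.1)) (⟨hst, le_rfl⟩ : t ∈ Icc s t)
    refine h.trans (mul_le_mul_of_nonneg_left ?_ (by positivity))
    linarith [Real.exp_pos (-c * t)]
  have hlim : Tendsto (fun s => K / c * Real.exp (-c * s)) atTop (𝓝 0) := by
    have h1 : Tendsto (fun s : ℝ => -c * s) atTop atBot :=
      tendsto_id.const_mul_atTop_of_neg (by linarith)
    simpa using (Real.tendsto_exp_atBot.comp h1).const_mul (K / c)
  have hcau : CauchySeq z := by
    rw [Metric.cauchySeq_iff']
    intro e he
    obtain ⟨s, hs, hs0⟩ := ((hlim.eventually (gt_mem_nhds he)).and (eventually_ge_atTop 0)).exists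
    exact ⟨s, fun t ht => by rw [dist_eq_norm]; exact (key s t hs0 ht).trans_lt hs⟩
  obtain ⟨l, hl⟩ := cauchySeq_tendsto_of_complete hcau
  refine ⟨l, fun s hs => ?_⟩
  have h1 : Tendsto (fun t => ‖z t - z s‖) atTop (𝓝 ‖l - z s‖) := (hl.sub_const _).norm
  rw [norm_sub_rev]
  exact le_of_tendsto h1 ((eventually_ge_atTop s).mono fun t ht => key s t hs ht)

/-- Exponential decay from a linear differential inequality. -/
theorem le_mul_exp_of_deriv_le {f f' : ℝ → ℝ} {c T : ℝ} (hT : 0 ≤ T)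
    (hf : ∀ t ∈ Icc 0 T, HasDerivAt f (f' t) t) (hb : ∀ t ∈ Icc 0 T, f' t ≤ -c * f t) :
    f T ≤ f 0 * Real.exp (-c * T) := by
  have hd : ∀ t ∈ Icc 0 T, HasDerivAt (fun t => f t * Real.exp (c * t))
      (f' t * Real.exp (c * t) + f t * (Real.exp (c * t) * (c * 1))) t := fun t ht =>
    (hf t ht).mul ((hasDerivAt_id t).const_mul c).exp
  have hanti : AntitoneOn (fun t => f t * Real.exp (c * t)) (Icc 0 T) := by
    refine antitoneOn_of_deriv_nonpos (convex_Icc 0 T)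
      (fun t ht => (hd t ht).continuousAt.continuousWithinAt)
      (fun t ht => (hd t (interior_subset ht)).differentiableAt.differentiableWithinAt) ?_
    intro t ht
    rw [(hd t (interior_subset ht)).deriv]
    nlinarith [hb t (interior_subset ht), Real.exp_pos (c * t)]
  have h := hanti (left_mem_Icc.2 hT) (right_mem_Icc.2 hT) hT
  simp only [mul_zero, Real.exp_zero, mul_one] at h
  rw [neg_mul, Real.exp_neg, ← div_eq_mul_inv]
  exact (le_div_iff₀ (Real.exp_pos _)).2 h

end ODE

/-! ### Symmetric operators with one negative direction -/

section Operator

variable {V : Type*} [NormedAddCommGroup V] [InnerProductSpace ℝ V]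

/-- `T` is symmetric, `u` is a unit eigenvector with eigenvalue `l ≤ -μ`, and `T ≥ μ` on the
orthogonal complement of `u`. -/
structure HasGap (T : V →L[ℝ] V) (μ : ℝ) (u : V) (l : ℝ) : Prop where
  symm : ∀ a b, inner ℝ (T a) b = inner ℝ a (T b)
  norm_eq : ‖u‖ = 1
  eigen : T u = l • u
  le_neg : l ≤ -μ
  coercive : ∀ w, inner ℝ u w = 0 → μ * ‖w‖ ^ 2 ≤ inner ℝ w (T w)

variable {T : V →L[ℝ] V} {μ l M η : ℝ} {u v : V}

/-- The part of `v` orthogonal to the lowest eigenvector is controlled by the residual. -/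
theorem HasGap.norm_sub_proj_le (h : HasGap T μ u l)
    (hR : inner ℝ v (T v) ≤ 0) :
    μ * ‖v - inner ℝ u v • u‖ ≤ ‖T v - inner ℝ v (T v) • v‖ := by
  set a := inner ℝ u v
  set w := v - a • u with hw
  set R := inner ℝ v (T v)
  have huw : inner ℝ u w = 0 := by
    rw [hw, inner_sub_right, inner_smul_right, real_inner_self_eq_norm_sq, h.norm_eq]; ring
  have hwu : inner ℝ w u = 0 := by rw [real_inner_comm]; exact huw
  have hv : v = a • u + w := by rw [hw]; abel
  have hTv : inner ℝ w (T v) = inner ℝ w (T w) := by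
    rw [hv, map_add, map_smul, h.eigen, inner_add_right, inner_smul_right, inner_smul_right, hwu]
    ring
  have hwv : inner ℝ w v = ‖w‖ ^ 2 := by
    rw [hv, inner_add_right, inner_smul_right, hwu, real_inner_self_eq_norm_sq]; ring
  -- The right side equals ⟨w, Tw⟩ - R‖w‖², and R ≤ 0 only helps.
  have h1 : μ * ‖w‖ ^ 2 ≤ inner ℝ w (T v - R • v) := by
    rw [inner_sub_right, inner_smul_right, hTv, hwv]
    nlinarith [h.coercive w huw, sq_nonneg ‖w‖]
  have h2 := real_inner_le_norm w (T v - R • v)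
  rcases (norm_nonneg w).eq_or_lt with h0 | h0
  · rw [← h0]; simp
  · nlinarith

/-- A vector with small residual and nonpositive Rayleigh quotient is close to the lowest
eigenvector, up to sign. -/
theorem HasGap.norm_sub_le (h : HasGap T μ u l) (hμ : 0 < μ) (hv : ‖v‖ = 1)
    (hR : inner ℝ v (T v) ≤ 0) (huv : 0 ≤ inner ℝ u v) :
    ‖v - u‖ ≤ 2 / μ * ‖T v - inner ℝ v (T v) • v‖ := by
  have h1 := h.norm_sub_proj_le hR
  have h2 : ‖v - u‖ ^ 2 = 2 - 2 * inner ℝ u v := by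
    rw [norm_sub_sq_real, hv, h.norm_eq, real_inner_comm]; ring
  have h3 : ‖v - inner ℝ u v • u‖ ^ 2 = 1 - inner ℝ u v ^ 2 := by
    rw [norm_sub_sq_real, norm_smul, hv, h.norm_eq, inner_smul_right, real_inner_comm,
      Real.norm_eq_abs, mul_one, sq_abs]
    ring
  -- With c = ⟨u, v⟩ in [0, 1], this is 2(1 - c) ≤ 4(1 - c)(1 + c).
  have h4 : ‖v - u‖ ≤ 2 * ‖v - inner ℝ u v • u‖ := by
    have h5 : inner ℝ u v ≤ 1 := by
      have := real_inner_le_norm u v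
      rwa [hv, h.norm_eq, mul_one] at this
    refine le_of_sq_le_sq ?_ (by positivity)
    rw [mul_pow, h2, h3]
    nlinarith
  rw [div_mul_eq_mul_div, le_div_iff₀ hμ]
  nlinarith

/-- A vector with small residual and nonpositive Rayleigh quotient has almost the lowest Rayleigh
quotient, and the operator is coercive on its orthogonal complement. -/
theorem HasGap.coercive_of_residual_le (h : HasGap T μ u l) (hμ : 0 < μ) (hv : ‖v‖ = 1)
    (hM : ‖T‖ ≤ M) (hη : (M + μ) * η ^ 2 ≤ μ ^ 3 / 2)
    (hR : inner ℝ v (T v) ≤ 0) (hr : ‖T v - inner ℝ v (T v) • v‖ ≤ η) :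
    inner ℝ v (T v) ≤ -(μ / 2) ∧ ∀ g, inner ℝ v g = 0 → μ / 2 * ‖g‖ ^ 2 ≤ inner ℝ g (T g) := by
  have h1 := h.norm_sub_proj_le hR
  set a := inner ℝ u v with ha
  set w := v - a • u with hw
  have hM0 : 0 ≤ M := (norm_nonneg T).trans hM
  have huu : inner ℝ u u = 1 := by rw [real_inner_self_eq_norm_sq, h.norm_eq]; norm_num
  have hdecomp : ∀ g : V, inner ℝ g (T g) =
      l * inner ℝ u g ^ 2 + inner ℝ (g - inner ℝ u g • u) (T (g - inner ℝ u g • u)) := by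
    intro g
    have e1 : inner ℝ u (T g) = l * inner ℝ u g := by
      rw [← h.symm, h.eigen, real_inner_smul_left]
    rw [map_sub, map_smul, h.eigen, inner_sub_left, inner_sub_right, inner_sub_right,
      real_inner_smul_left, real_inner_smul_left, inner_smul_right, inner_smul_right,
      inner_smul_right, inner_smul_right, e1, huu, real_inner_comm u g]
    ring
  have hortho : ∀ g : V, inner ℝ u (g - inner ℝ u g • u) = 0 := by
    intro g; rw [inner_sub_right, inner_smul_right, huu]; ring
  have hpyth : ∀ g : V, ‖g - inner ℝ u g • u‖ ^ 2 = ‖g‖ ^ 2 - inner ℝ u g ^ 2 := by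
    intro g
    rw [norm_sub_sq_real, norm_smul, h.norm_eq, inner_smul_right, real_inner_comm,
      Real.norm_eq_abs, mul_one, sq_abs]
    ring
  have hq : ∀ g : V, |inner ℝ g (T g)| ≤ M * ‖g‖ ^ 2 := by
    intro g
    calc |inner ℝ g (T g)| ≤ ‖g‖ * ‖T g‖ := abs_real_inner_le_norm _ _
      _ ≤ ‖g‖ * (M * ‖g‖) := by
        gcongr; exact (T.le_opNorm g).trans (by gcongr)
      _ = M * ‖g‖ ^ 2 := by ring
  have hwsq : μ ^ 2 * ‖w‖ ^ 2 ≤ η ^ 2 := by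
    rw [← mul_pow]; exact pow_le_pow_left₀ (by positivity) (h1.trans hr) 2
  have hsmall : (M + μ) * ‖w‖ ^ 2 ≤ μ / 2 := by
    have : μ ^ 2 * ((M + μ) * ‖w‖ ^ 2) ≤ μ ^ 2 * (μ / 2) := by nlinarith
    exact le_of_mul_le_mul_left this (by positivity)
  have hl : -M ≤ l := by
    have := hq u
    rw [h.eigen, inner_smul_right, huu, h.norm_eq] at this
    have := (abs_le.1 this).1
    linarith
  have hww : ‖w‖ ^ 2 = 1 - a ^ 2 := by rw [hw, ha, hpyth v, hv]; ring
  refine ⟨?_, fun g hg => ?_⟩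
  -- R ≤ -μ(1 - ‖w‖²) + M‖w‖² = -μ + (M + μ)‖w‖² ≤ -μ/2.
  · rw [hdecomp v]
    have h2 := (abs_le.1 (hq w)).2
    have h3 : l * a ^ 2 ≤ -μ * a ^ 2 := mul_le_mul_of_nonneg_right h.le_neg (sq_nonneg a)
    nlinarith
  -- As g is orthogonal to v, its component along u only sees u - a v, which has the same norm as w.
  · have hb : inner ℝ u g ^ 2 ≤ ‖w‖ ^ 2 * ‖g‖ ^ 2 := by
      have e1 : inner ℝ u g = inner ℝ (u - a • v) g := by
        rw [inner_sub_left, real_inner_smul_left, hg]; ring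
      have e2 : ‖u - a • v‖ ^ 2 = ‖w‖ ^ 2 := by
        rw [hww, norm_sub_sq_real, norm_smul, hv, h.norm_eq, inner_smul_right, ← ha,
          Real.norm_eq_abs, mul_one, sq_abs]
        ring
      rw [e1, ← e2, ← mul_pow, ← sq_abs (inner ℝ _ _)]
      exact pow_le_pow_left₀ (abs_nonneg _) (abs_real_inner_le_norm _ _) 2
    rw [hdecomp g]
    have h2 := h.coercive _ (hortho g)
    rw [hpyth g] at h2
    have h3 : -M * inner ℝ u g ^ 2 ≤ l * inner ℝ u g ^ 2 :=
      mul_le_mul_of_nonneg_right hl (sq_nonneg _)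
    have h4 : (M + μ) * inner ℝ u g ^ 2 ≤ (M + μ) * (‖w‖ ^ 2 * ‖g‖ ^ 2) :=
      mul_le_mul_of_nonneg_left hb (by positivity)
    have h5 : (M + μ) * ‖w‖ ^ 2 * ‖g‖ ^ 2 ≤ μ / 2 * ‖g‖ ^ 2 :=
      mul_le_mul_of_nonneg_right hsmall (sq_nonneg _)
    nlinarith

/-- For a symmetric operator, reflecting one argument across `v` cancels the mixed terms. -/
theorem half_mul_norm_sq_le_inner_reflection
    (hsymm : ∀ a b, inner ℝ (T a) b = inner ℝ a (T b)) (hv : ‖v‖ = 1)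
    (hR : inner ℝ v (T v) ≤ -(μ / 2))
    (hg : ∀ g, inner ℝ v g = 0 → μ / 2 * ‖g‖ ^ 2 ≤ inner ℝ g (T g)) (f : V) :
    μ / 2 * ‖f‖ ^ 2 ≤ inner ℝ f (T (f - (2 * inner ℝ v f) • v)) := by
  set b := inner ℝ v f with hb
  have hvv : inner ℝ v v = 1 := by rw [real_inner_self_eq_norm_sq, hv]; norm_num
  have h1 := hg (f - b • v) (by rw [inner_sub_right, inner_smul_right, hvv, ← hb]; ring)
  have h2 : ‖f - b • v‖ ^ 2 = ‖f‖ ^ 2 - b ^ 2 := by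
    rw [norm_sub_sq_real, norm_smul, hv, inner_smul_right, real_inner_comm, ← hb,
      Real.norm_eq_abs, mul_one, sq_abs]
    ring
  have h3 : inner ℝ v (T f) = inner ℝ f (T v) := by rw [← hsymm, real_inner_comm]
  have h4 : inner ℝ f (T (f - (2 * b) • v)) =
      -b ^ 2 * inner ℝ v (T v) + inner ℝ (f - b • v) (T (f - b • v)) := by
    simp only [map_sub, map_smul, inner_sub_left, inner_sub_right, real_inner_smul_left,
      inner_smul_right, h3]
    ring
  rw [h4]
  rw [h2] at h1
  nlinarith [sq_nonneg b]

theorem norm_sub_two_inner_smul (hv : ‖v‖ = 1) (f : V) :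
    ‖f - (2 * inner ℝ v f) • v‖ = ‖f‖ := by
  rw [← sq_eq_sq₀ (norm_nonneg _) (norm_nonneg _), norm_sub_sq_real, norm_smul, hv,
    inner_smul_right, real_inner_comm, Real.norm_eq_abs, mul_one, sq_abs]
  ring

theorem norm_sub_inner_smul_sq (hv : ‖v‖ = 1) (f : V) :
    ‖f - inner ℝ v f • v‖ ^ 2 = ‖f‖ ^ 2 - inner ℝ v f ^ 2 := by
  rw [norm_sub_sq_real, norm_smul, hv,
    inner_smul_right, real_inner_comm, Real.norm_eq_abs, mul_one, sq_abs]
  ring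

end Operator

/-! ### Residuals of approximate eigenvectors -/

section Residual

variable {V : Type*} [NormedAddCommGroup V] [InnerProductSpace ℝ V] {T : V →L[ℝ] V} {v : V}

/-- The Rayleigh quotient minimizes the residual. -/
theorem norm_residual_le (hv : ‖v‖ = 1) (l : ℝ) :
    ‖T v - inner ℝ v (T v) • v‖ ≤ ‖T v - l • v‖ := by
  have hvv : inner ℝ v v = 1 := by rw [real_inner_self_eq_norm_sq, hv]; norm_num
  refine le_of_sq_le_sq ?_ (norm_nonneg _)
  rw [norm_sub_inner_smul_sq hv, norm_sub_sq_real, norm_smul, hv, inner_smul_right,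
    real_inner_comm v (T v), Real.norm_eq_abs, mul_one, sq_abs]
  -- The squared norms differ by exactly (⟨v, Tv⟩ - l)².
  nlinarith [sq_nonneg (inner ℝ v (T v) - l)]

/-- Passes negativity from an approximate eigenvalue to the Rayleigh quotient. -/
theorem rayleigh_le (hv : ‖v‖ = 1) (l : ℝ) :
    inner ℝ v (T v) ≤ l + ‖T v - l • v‖ := by
  have h := real_inner_le_norm v (T v - l • v)
  rw [inner_sub_right, inner_smul_right, real_inner_self_eq_norm_sq, hv] at h
  linarith

end Residual

/-! ### The Hessian along the dynamics, and its spectral gap at index-one points -/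

section Hessian

variable {N : ℕ} {E : EuclideanSpace ℝ (Fin N) → ℝ}

theorem contDiff_gradient (hE : ContDiff ℝ 3 E) : ContDiff ℝ 2 (gradient E) := by
  have h : ContDiff ℝ 2 (fderiv ℝ E) := hE.fderiv_right (by norm_num)
  exact (InnerProductSpace.toDual ℝ (EuclideanSpace ℝ (Fin N))).symm.contDiff.comp h

theorem contDiff_hessian (hE : ContDiff ℝ 3 E) : ContDiff ℝ 1 (hessian E) :=
  (contDiff_gradient hE).fderiv_right (by norm_num)

theorem hasFDerivAt_gradient (hE : ContDiff ℝ 3 E) (x : EuclideanSpace ℝ (Fin N)) :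
    HasFDerivAt (gradient E) (hessian E x) x :=
  ((contDiff_gradient hE).differentiable two_ne_zero x).hasFDerivAt

/-- The Rayleigh quotient `⟨v, ∇²E(x) v⟩`. -/
noncomputable def rayleigh (E : EuclideanSpace ℝ (Fin N) → ℝ)
    (p : EuclideanSpace ℝ (Fin N) × EuclideanSpace ℝ (Fin N)) : ℝ :=
  inner ℝ p.2 (hessian E p.1 p.2)

/-- For unit `v`, the squared norm of the residual `∇²E(x) v - ⟨v, ∇²E(x) v⟩ v`. -/
noncomputable def residualSq (E : EuclideanSpace ℝ (Fin N) → ℝ)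
    (p : EuclideanSpace ℝ (Fin N) × EuclideanSpace ℝ (Fin N)) : ℝ :=
  ‖hessian E p.1 p.2‖ ^ 2 - rayleigh E p ^ 2

theorem norm_residual_sq {p : EuclideanSpace ℝ (Fin N) × EuclideanSpace ℝ (Fin N)}
    (hp : ‖p.2‖ = 1) :
    ‖hessian E p.1 p.2 - rayleigh E p • p.2‖ ^ 2 = residualSq E p :=
  norm_sub_inner_smul_sq hp _

theorem continuous_rayleigh (hE : ContDiff ℝ 3 E) : Continuous (rayleigh E) := by
  have hHc : Continuous (hessian E) := (contDiff_hessian hE).continuous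
  unfold rayleigh
  fun_prop

theorem continuous_residualSq (hE : ContDiff ℝ 3 E) : Continuous (residualSq E) := by
  have hHc : Continuous (hessian E) := (contDiff_hessian hE).continuous
  have := continuous_rayleigh hE
  unfold residualSq
  fun_prop

/-- The right-hand side of the gentlest ascent dynamics, with time scale `k = ε⁻²` for `v`. -/
noncomputable def gadField (E : EuclideanSpace ℝ (Fin N) → ℝ) (k : ℝ)
    (p : EuclideanSpace ℝ (Fin N) × EuclideanSpace ℝ (Fin N)) :
    EuclideanSpace ℝ (Fin N) × EuclideanSpace ℝ (Fin N) :=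
  (-(gradient E p.1 - (2 * inner ℝ p.2 (gradient E p.1)) • p.2),
    -(k • (hessian E p.1 p.2 - inner ℝ p.2 (hessian E p.1 p.2) • p.2)))

theorem contDiff_gadField (hE : ContDiff ℝ 3 E) (k : ℝ) : ContDiff ℝ 1 (gadField E k) := by
  have hH : ContDiff ℝ 1 (hessian E) := contDiff_hessian hE
  have hF : ContDiff ℝ 1 (gradient E) := (contDiff_gradient hE).of_le (by norm_num)
  have hF1 : ContDiff ℝ 1 (fun p : EuclideanSpace ℝ (Fin N) × EuclideanSpace ℝ (Fin N) =>
    gradient E p.1) := hF.comp contDiff_fst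
  have hH1 : ContDiff ℝ 1 (fun p : EuclideanSpace ℝ (Fin N) × EuclideanSpace ℝ (Fin N) =>
    hessian E p.1 p.2) := (hH.comp contDiff_fst).clm_apply contDiff_snd
  unfold gadField
  exact (((hF1.sub ((contDiff_const.mul (contDiff_snd.inner ℝ hF1)).smul contDiff_snd)).neg).prodMk
    ((hH1.sub ((contDiff_snd.inner ℝ hH1).smul contDiff_snd)).const_smul k).neg)

variable {Ω : Set (EuclideanSpace ℝ (Fin N))} {η : ℝ}

/-- The set of states with small residual on which the Rayleigh quotient is nonpositive. -/
structure IsAligned (E : EuclideanSpace ℝ (Fin N) → ℝ) (Ω : Set (EuclideanSpace ℝ (Fin N)))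
    (η : ℝ) (p : EuclideanSpace ℝ (Fin N) × EuclideanSpace ℝ (Fin N)) : Prop where
  mem : p.1 ∈ Ω
  norm_eq : ‖p.2‖ = 1
  rayleigh_le : rayleigh E p ≤ 0
  residualSq_le : residualSq E p ≤ η ^ 2

theorem IsAligned.norm_residual_le {p : EuclideanSpace ℝ (Fin N) × EuclideanSpace ℝ (Fin N)}
    (hp : IsAligned E Ω η p) (hη : 0 ≤ η) :
    ‖hessian E p.1 p.2 - rayleigh E p • p.2‖ ≤ η :=
  le_of_sq_le_sq ((norm_residual_sq hp.norm_eq).trans_le hp.residualSq_le) hη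

variable {z : ℝ → EuclideanSpace ℝ (Fin N) × EuclideanSpace ℝ (Fin N)} {k : ℝ}

/-- The dynamics preserves the norm of a unit direction. -/
theorem norm_snd_eq_one_of_hasDerivAt (hE : ContDiff ℝ 3 E) {T : ℝ} (hz : Continuous z)
    (hd : ∀ s ∈ Icc 0 T, HasDerivAt z (gadField E k (z s)) s) (h0 : ‖(z 0).2‖ = 1) :
    ∀ s ∈ Icc 0 T, ‖(z s).2‖ = 1 := by
  obtain ⟨K, hK⟩ := (isCompact_Icc (a := (0 : ℝ)) (b := T)).exists_bound_of_continuousOn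
    (f := fun s => 2 * k * rayleigh E (z s))
    (continuous_const.mul ((continuous_rayleigh hE).comp hz)).continuousOn
  -- The defect ‖v‖² - 1 solves a linear homogeneous equation with bounded coefficient, so Grönwall
  -- keeps it at 0.
  have hd' : ∀ s ∈ Icc 0 T, HasDerivAt (fun s => ‖(z s).2‖ ^ 2 - 1)
      (2 * k * rayleigh E (z s) * (‖(z s).2‖ ^ 2 - 1)) s := by
    intro s hs
    have hv : HasDerivAt (fun s => (z s).2) (gadField E k (z s)).2 s := (hd s hs).snd
    convert! (hv.norm_sq).sub_const 1 using 1
    simp only [gadField, rayleigh, inner_neg_right, inner_smul_right, inner_sub_right,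
      real_inner_self_eq_norm_sq]
    ring
  have h1 := eq_zero_of_abs_deriv_le_mul_abs_self_of_eq_zero_right (K := K)
    (f := fun s => ‖(z s).2‖ ^ 2 - 1)
    (fun s hs => (hd' s hs).continuousAt.continuousWithinAt)
    (fun s hs => (hd' s (Ico_subset_Icc_self hs)).hasDerivWithinAt) (by simp [h0])
    (fun s hs => by
      rw [norm_mul]
      exact mul_le_mul_of_nonneg_right (hK s (Ico_subset_Icc_self hs)) (norm_nonneg _))
  intro s hs
  have h2 : ‖(z s).2‖ ^ 2 = 1 := sub_eq_zero.1 (h1 s hs)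
  exact (pow_eq_one_iff_of_nonneg (norm_nonneg _) two_ne_zero).1 h2

/-- The velocity of an aligned state is controlled by the Lyapunov function. -/
theorem IsAligned.norm_gadField_le {p : EuclideanSpace ℝ (Fin N) × EuclideanSpace ℝ (Fin N)}
    (hp : IsAligned E Ω η p) (hk : 0 ≤ k) {e A b : ℝ} (hA : 0 ≤ A) (hb : 0 ≤ b) (he : 0 ≤ e)
    (h1 : ‖gradient E p.1‖ ^ 2 ≤ (A * e) ^ 2) (h2 : residualSq E p ≤ (b * e) ^ 2) :
    ‖gadField E k p‖ ≤ (A + k * b) * e := by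
  have h3 : ‖gradient E p.1‖ ≤ A * e := le_of_sq_le_sq h1 (by positivity)
  have h4 : ‖hessian E p.1 p.2 - rayleigh E p • p.2‖ ≤ b * e :=
    le_of_sq_le_sq ((norm_residual_sq hp.norm_eq).trans_le h2) (by positivity)
  have h5 : 0 ≤ k * b * e := by positivity
  have h6 : 0 ≤ A * e := by positivity
  rw [Prod.norm_def]
  refine max_le ?_ ?_
  · rw [gadField, norm_neg, norm_sub_two_inner_smul hp.norm_eq]
    linarith
  · change ‖-(k • (hessian E p.1 p.2 - rayleigh E p • p.2))‖ ≤ _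
    rw [norm_neg, norm_smul, Real.norm_eq_abs, abs_of_nonneg hk]
    have := mul_le_mul_of_nonneg_left h4 hk
    linarith

/-- The gentlest ascent dynamics in product form. -/
theorem IsGADSolution.hasDerivWithinAt {ε : ℝ} {x₀ v₀ : EuclideanSpace ℝ (Fin N)}
    {x v : ℝ → EuclideanSpace ℝ (Fin N)} (h : IsGADSolution E ε x₀ v₀ x v) {t : ℝ} (ht : 0 ≤ t) :
    HasDerivWithinAt (fun t => (x t, v t)) (gadField E (ε ^ 2)⁻¹ (x t, v t)) (Ici 0) t :=
  (h.x_deriv t ht).prodMk (h.v_deriv t ht)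

variable [NeZero N]

/-- No eigenvalue vanishes. This yields both the uniform gap and the openness of ∇E. -/
theorem HasIndexOne.injective {x : EuclideanSpace ℝ (Fin N)} (h : HasIndexOne E x)
    {w : EuclideanSpace ℝ (Fin N)} (hw : hessian E x w = 0) : w = 0 := by
  obtain ⟨hH, h0, hpos⟩ := h
  set b := hH.eigenvectorBasis finrank_euclideanSpace_fin
  refine b.toBasis.ext_elem fun i => ?_
  have hne : hH.eigenvalues finrank_euclideanSpace_fin i ≠ 0 := by
    have hi : hH.eigenvalues finrank_euclideanSpace_fin i = eig hH i.rev := by simp [eig]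
    rw [hi]
    by_cases h : i.rev = 0
    · rw [h]; exact h0.ne
    · exact (hpos _ h).ne'
  have h1 := hH.eigenvectorBasis_apply_self_apply finrank_euclideanSpace_fin w i
  have h2 : (hessian E x : EuclideanSpace ℝ (Fin N) →ₗ[ℝ] EuclideanSpace ℝ (Fin N)) w = 0 := hw
  rw [h2] at h1
  have h3 : b.repr w i = 0 := by
    simpa [hne, b] using h1
  simpa using h3

/-- Testing the hypothesis on unit eigenvectors gives |λᵢ| ≥ μ for all i; the known signs turn this
into a gap around 0. -/
theorem HasIndexOne.exists_hasGap {x : EuclideanSpace ℝ (Fin N)} (h : HasIndexOne E x) {μ : ℝ}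
    (hμ : ∀ w, ‖w‖ = 1 → μ ≤ ‖hessian E x w‖) :
    ∃ u, ∃ hH : (hessian E x : EuclideanSpace ℝ (Fin N) →ₗ[ℝ]
      EuclideanSpace ℝ (Fin N)).IsSymmetric, HasGap (hessian E x) μ u (eig hH 0) := by
  obtain ⟨hH, h0, hpos⟩ := h
  set b := hH.eigenvectorBasis finrank_euclideanSpace_fin with hb
  have happ : ∀ i : Fin N, hessian E x (b i.rev) = eig hH i • b i.rev := fun i =>
    hH.apply_eigenvectorBasis finrank_euclideanSpace_fin i.rev
  have hnorm : ∀ i, ‖b i‖ = 1 := fun i => b.orthonormal.1 i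
  have habs : ∀ i, μ ≤ |eig hH i| := fun i => by
    have := hμ _ (hnorm i.rev)
    rwa [happ, norm_smul, hnorm, mul_one, Real.norm_eq_abs] at this
  refine ⟨b (Fin.rev 0), hH, fun a c => hH a c, hnorm _, happ 0, ?_, fun w hw => ?_⟩
  · have := habs 0
    rw [abs_of_neg h0] at this
    linarith
  · have h1 : inner ℝ w (hessian E x w) = ∑ i, eig hH i.rev * inner ℝ (b i) w ^ 2 := by
      rw [← b.sum_inner_mul_inner w (hessian E x w)]
      refine Finset.sum_congr rfl fun i _ => ?_
      have h2 : inner ℝ (b i) (hessian E x w) = inner ℝ (hessian E x (b i)) w :=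
        (hH (b i) w).symm
      have h3 := happ i.rev
      rw [Fin.rev_rev] at h3
      rw [h2, h3, real_inner_smul_left, real_inner_comm]
      ring
    have h2 : ‖w‖ ^ 2 = ∑ i, inner ℝ (b i) w ^ 2 := by
      rw [← b.sum_sq_norm_inner_right w]
      simp
    rw [h1, h2, Finset.mul_sum]
    refine Finset.sum_le_sum fun i _ => ?_
    by_cases hi : i.rev = 0
    · have : i = Fin.rev 0 := by rw [← hi, Fin.rev_rev]
      rw [this, hw]; simp
    · have := habs i.rev
      rw [abs_of_pos (hpos _ hi)] at this
      exact mul_le_mul_of_nonneg_right this (sq_nonneg _)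

end Hessian

/-! ### Uniform constants on Ω and the decay estimates -/

section Uniform

variable {N : ℕ} [NeZero N]

/-- Uniform bounds for the second and third derivatives of `E` on a set of index-one points. -/
structure HasUniformBounds (E : EuclideanSpace ℝ (Fin N) → ℝ) (Ω : Set (EuclideanSpace ℝ (Fin N)))
    (μ M B : ℝ) : Prop where
  contDiff : ContDiff ℝ 3 E
  pos : 0 < μ
  gap : ∀ x ∈ Ω, ∃ u, ∃ hH : (hessian E x : EuclideanSpace ℝ (Fin N) →ₗ[ℝ]
      EuclideanSpace ℝ (Fin N)).IsSymmetric, HasGap (hessian E x) μ u (eig hH 0)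
  norm_hessian_le : ∀ x ∈ Ω, ‖hessian E x‖ ≤ M
  norm_fderiv_le : ∀ x ∈ Ω, ‖fderiv ℝ (hessian E) x‖ ≤ B
  M_nonneg : 0 ≤ M
  B_nonneg : 0 ≤ B

/-- The gap μ is the minimum of ‖∇²E(x) w‖ over the compact set of x in Ω and unit w, which avoids
continuity of eigenvalues. -/
theorem exists_hasUniformBounds {E : EuclideanSpace ℝ (Fin N) → ℝ} (hE : ContDiff ℝ 3 E)
    {Ω : Set (EuclideanSpace ℝ (Fin N))} (hΩ : IsCompact Ω) (hne : Ω.Nonempty)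
    (hindex : ∀ x ∈ Ω, HasIndexOne E x) :
    ∃ μ M B, HasUniformBounds E Ω μ M B := by
  have hHc : Continuous (hessian E) := (contDiff_hessian hE).continuous
  obtain ⟨M, hM⟩ := hΩ.exists_bound_of_continuousOn hHc.continuousOn
  obtain ⟨B, hB⟩ := hΩ.exists_bound_of_continuousOn
    ((contDiff_hessian hE).continuous_fderiv one_ne_zero).continuousOn
  have hS : (Metric.sphere (0 : EuclideanSpace ℝ (Fin N)) 1).Nonempty :=
    NormedSpace.sphere_nonempty.2 zero_le_one
  have hc : Continuous fun p : EuclideanSpace ℝ (Fin N) × EuclideanSpace ℝ (Fin N) =>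
      ‖hessian E p.1 p.2‖ :=
    ((hHc.comp continuous_fst).clm_apply continuous_snd).norm
  obtain ⟨p, hp, hmin⟩ := (hΩ.prod (isCompact_sphere 0 1)).exists_isMinOn (hne.prod hS)
    hc.continuousOn
  obtain ⟨x, hx⟩ := hne
  refine ⟨‖hessian E p.1 p.2‖, M, B, hE, ?_, fun x hx => ?_, hM, hB,
    (norm_nonneg _).trans (hM x hx), (norm_nonneg _).trans (hB x hx)⟩
  · rw [norm_pos_iff]
    intro h0
    have h1 := (hindex p.1 hp.1).injective h0
    have h2 := hp.2
    rw [mem_sphere_zero_iff_norm, h1, norm_zero] at h2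
    exact zero_ne_one h2
  · refine (hindex x hx).exists_hasGap fun w hw => ?_
    exact isMinOn_iff.1 hmin (x, w) ⟨hx, mem_sphere_zero_iff_norm.2 hw⟩

variable {E : EuclideanSpace ℝ (Fin N) → ℝ} {Ω : Set (EuclideanSpace ℝ (Fin N))} {μ M B η : ℝ}

theorem HasUniformBounds.coercive (h : HasUniformBounds E Ω μ M B) (hη : 0 ≤ η)
    (hη' : (M + μ) * η ^ 2 ≤ μ ^ 3 / 2)
    {p : EuclideanSpace ℝ (Fin N) × EuclideanSpace ℝ (Fin N)} (hp : IsAligned E Ω η p) :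
    rayleigh E p ≤ -(μ / 2) ∧
      ∀ g, inner ℝ p.2 g = 0 → μ / 2 * ‖g‖ ^ 2 ≤ inner ℝ g (hessian E p.1 g) := by
  obtain ⟨u, hH, hgap⟩ := h.gap p.1 hp.mem
  exact hgap.coercive_of_residual_le h.pos hp.norm_eq (h.norm_hessian_le _ hp.mem) hη'
    hp.rayleigh_le (hp.norm_residual_le hη)

theorem HasUniformBounds.symm (h : HasUniformBounds E Ω μ M B) {x : EuclideanSpace ℝ (Fin N)}
    (hx : x ∈ Ω) (a b : EuclideanSpace ℝ (Fin N)) :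
    inner ℝ (hessian E x a) b = inner ℝ a (hessian E x b) := by
  obtain ⟨u, hH, hgap⟩ := h.gap x hx
  exact hgap.symm a b

variable {z : ℝ → EuclideanSpace ℝ (Fin N) × EuclideanSpace ℝ (Fin N)} {k t : ℝ}

/-- The gradient norm decreases along the dynamics as long as `v` is aligned. -/
theorem HasUniformBounds.exists_deriv_gradient (h : HasUniformBounds E Ω μ M B) (hη : 0 ≤ η)
    (hη' : (M + μ) * η ^ 2 ≤ μ ^ 3 / 2) (hp : IsAligned E Ω η (z t))
    (hz : HasDerivAt z (gadField E k (z t)) t) :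
    ∃ d, HasDerivAt (fun s => ‖gradient E (z s).1‖ ^ 2) d t ∧
      d ≤ -μ * ‖gradient E (z t).1‖ ^ 2 := by
  have hx : HasDerivAt (fun s => (z s).1) _ t := hz.fst
  have hF := ((hasFDerivAt_gradient h.contDiff (z t).1).comp_hasDerivAt t hx).norm_sq
  refine ⟨_, hF, ?_⟩
  obtain ⟨h1, h2⟩ := h.coercive hη hη' hp
  have h3 := half_mul_norm_sq_le_inner_reflection (h.symm hp.mem) hp.norm_eq h1 h2
    (gradient E (z t).1)
  simp only [gadField, map_neg, inner_neg_right, Function.comp_apply]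
  linarith

/-- The residual is damped at rate `k`, up to the motion of `x`. -/
theorem HasUniformBounds.exists_deriv_residualSq (h : HasUniformBounds E Ω μ M B) (hη : 0 ≤ η)
    (hη' : (M + μ) * η ^ 2 ≤ μ ^ 3 / 2) (hk : 0 ≤ k) (hp : IsAligned E Ω η (z t))
    (hz : HasDerivAt z (gadField E k (z t)) t) :
    ∃ d, HasDerivAt (fun s => residualSq E (z s)) d t ∧
      d ≤ 2 * B * ‖gradient E (z t).1‖ * ‖hessian E (z t).1 (z t).2 - rayleigh E (z t) • (z t).2‖
        - k * μ * residualSq E (z t) := by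
  have hx : HasDerivAt (fun s => (z s).1) (gadField E k (z t)).1 t := hz.fst
  have hv : HasDerivAt (fun s => (z s).2) (gadField E k (z t)).2 t := hz.snd
  have hHx : HasDerivAt (fun s => hessian E (z s).1)
      (fderiv ℝ (hessian E) (z t).1 (gadField E k (z t)).1) t :=
    (((contDiff_hessian h.contDiff).differentiable one_ne_zero
      (z t).1).hasFDerivAt).comp_hasDerivAt t hx
  have hHv := hHx.clm_apply hv
  have hR := hv.inner ℝ hHv
  refine ⟨_, hHv.norm_sq.sub (hR.pow 2), ?_⟩
  obtain ⟨h1, h2⟩ := h.coercive hη hη' hp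
  have hsymm := h.symm hp.mem
  have hq := norm_residual_sq (E := E) hp.norm_eq
  have hdx : ‖(gadField E k (z t)).1‖ = ‖gradient E (z t).1‖ := by
    rw [gadField, norm_neg, norm_sub_two_inner_smul hp.norm_eq]
  have hdv : (gadField E k (z t)).2 =
      -(k • (hessian E (z t).1 (z t).2 - rayleigh E (z t) • (z t).2)) := rfl
  set x := (z t).1
  set v := (z t).2
  set D := fderiv ℝ (hessian E) x (gadField E k (z t)).1
  have hRdef : inner ℝ v (hessian E x v) = rayleigh E (z t) := rfl
  set R := rayleigh E (z t)
  set T := hessian E x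
  set r := T v - R • v with hr
  have hvv : inner ℝ v v = 1 := by rw [real_inner_self_eq_norm_sq, hp.norm_eq]; norm_num
  have hvr : inner ℝ v r = 0 := by rw [hr, inner_sub_right, inner_smul_right, hvv, hRdef]; ring
  have hTv : T v = R • v + r := by rw [hr]; abel
  have hrr : inner ℝ r r = ‖r‖ ^ 2 := real_inner_self_eq_norm_sq r
  have hvTr : inner ℝ v (T r) = ‖r‖ ^ 2 := by
    rw [← hsymm, hTv, inner_add_left, real_inner_smul_left, hvr, hrr]; ring
  have hTvr : inner ℝ (T v) r = ‖r‖ ^ 2 := by rw [hsymm, hvTr]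
  have hDle : inner ℝ r (D v) ≤ B * ‖gradient E x‖ * ‖r‖ := by
    calc inner ℝ r (D v) ≤ ‖r‖ * ‖D v‖ := real_inner_le_norm _ _
      _ ≤ ‖r‖ * (B * ‖gradient E x‖) := by
        gcongr
        calc ‖D v‖ ≤ ‖D‖ * ‖v‖ := D.le_opNorm v
          _ = ‖D‖ := by rw [hp.norm_eq, mul_one]
          _ ≤ ‖fderiv ℝ (hessian E) x‖ * ‖(gadField E k (z t)).1‖ :=
            ContinuousLinearMap.le_opNorm _ _
          _ ≤ B * ‖gradient E x‖ := by
            rw [hdx]; gcongr; exact h.norm_fderiv_le _ hp.mem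
      _ = B * ‖gradient E x‖ * ‖r‖ := by ring
  have hTvD : inner ℝ (T v) (D v) = R * inner ℝ v (D v) + inner ℝ r (D v) := by
    rw [hTv, inner_add_left, real_inner_smul_left]
  have hTvTr : inner ℝ (T v) (T r) = R * ‖r‖ ^ 2 + inner ℝ r (T r) := by
    nth_rewrite 1 [hTv]
    rw [inner_add_left, real_inner_smul_left, hvTr]
  have hcr := h2 r hvr
  -- The left side is the derivative of ‖Tv‖² - R² in the form given by the product and power rules.
  -- Inserting Tv = Rv + r and v' = -k r cancels the terms R⟨v, Dv⟩.
  have hid : 2 * inner ℝ (T v) (D v + T (gadField E k (z t)).2) -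
      2 * R ^ (2 - 1) * (inner ℝ v (D v + T (gadField E k (z t)).2) +
        inner ℝ (gadField E k (z t)).2 (T v)) =
      2 * inner ℝ r (D v) - 2 * k * (inner ℝ r (T r) - R * ‖r‖ ^ 2) := by
    rw [hdv, map_neg, map_smul, inner_neg_left, real_inner_smul_left, real_inner_comm (T v) r,
      hTvr]
    simp only [inner_add_right, inner_neg_right, inner_smul_right]
    rw [hTvD, hTvTr, hvTr]
    ring
  rw [← hq]
  refine (le_of_eq ?_).trans (b := 2 * inner ℝ r (D v) - 2 * k * (inner ℝ r (T r) - R * ‖r‖ ^ 2)) ?_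
  · rw [← hid]
    simp [R, rayleigh, x, v, T]
  · have hRn : R * ‖r‖ ^ 2 ≤ 0 := mul_nonpos_of_nonpos_of_nonneg hp.rayleigh_le (sq_nonneg _)
    have : k * (μ / 2 * ‖r‖ ^ 2) ≤ k * (inner ℝ r (T r) - R * ‖r‖ ^ 2) :=
      mul_le_mul_of_nonneg_left (by linarith) hk
    nlinarith

/-- Exponential decay rate of the Lyapunov function `a ‖∇E‖² + ‖r‖²`. -/
theorem HasUniformBounds.exists_deriv_lyapunov (h : HasUniformBounds E Ω μ M B) (hη : 0 ≤ η)
    (hη' : (M + μ) * η ^ 2 ≤ μ ^ 3 / 2) {a : ℝ} (ha : 0 < a)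
    (hk : 1 / 2 + 2 * B ^ 2 / (a * μ ^ 2) ≤ k) (hp : IsAligned E Ω η (z t))
    (hz : HasDerivAt z (gadField E k (z t)) t) :
    ∃ d, HasDerivAt (fun s => a * ‖gradient E (z s).1‖ ^ 2 + residualSq E (z s)) d t ∧
      d ≤ -(μ / 2) * (a * ‖gradient E (z t).1‖ ^ 2 + residualSq E (z t)) := by
  have hμ := h.pos
  have hk0 : 0 ≤ k := le_trans (by positivity) hk
  obtain ⟨d₁, hd₁, hle₁⟩ := h.exists_deriv_gradient hη hη' hp hz
  obtain ⟨d₂, hd₂, hle₂⟩ := h.exists_deriv_residualSq hη hη' hk0 hp hz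
  refine ⟨a * d₁ + d₂, (hd₁.const_mul a).add hd₂, ?_⟩
  rw [← norm_residual_sq (E := E) hp.norm_eq] at hle₂ ⊢
  set f := ‖gradient E (z t).1‖
  set s := ‖hessian E (z t).1 (z t).2 - rayleigh E (z t) • (z t).2‖
  have h1 : a * d₁ ≤ a * (-μ * f ^ 2) := mul_le_mul_of_nonneg_left hle₁ ha.le
  -- Young's inequality, weighted to spend half of the gradient decay aμf². The lower bound on k is
  -- what absorbs the s² term and still leaves the rate μ/2.
  have h2 : 2 * B * f * s ≤ a * μ / 2 * f ^ 2 + 2 * B ^ 2 / (a * μ) * s ^ 2 := by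
    have h3 : a * μ / 2 * f ^ 2 + 2 * B ^ 2 / (a * μ) * s ^ 2 - 2 * B * f * s =
        (a * μ * f - 2 * B * s) ^ 2 / (2 * (a * μ)) := by
      field_simp
      ring
    have h4 : 0 ≤ (a * μ * f - 2 * B * s) ^ 2 / (2 * (a * μ)) := by positivity
    linarith
  have h5 : (μ / 2 + 2 * B ^ 2 / (a * μ)) * s ^ 2 ≤ k * μ * s ^ 2 := by
    refine mul_le_mul_of_nonneg_right ?_ (sq_nonneg s)
    have h6 := mul_le_mul_of_nonneg_right hk hμ.le
    have h7 : (1 / 2 + 2 * B ^ 2 / (a * μ ^ 2)) * μ = μ / 2 + 2 * B ^ 2 / (a * μ) := by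
      field_simp
    linarith
  nlinarith

end Uniform

/-! ### Invariance of the component, and the sign of the eigenvector -/

theorem isClosed_connectedComponentIn {X : Type*} [TopologicalSpace X] {S : Set X}
    (hS : IsClosed S) {p : X} (hp : p ∈ S) : IsClosed (connectedComponentIn S p) := by
  refine closure_subset_iff_isClosed.1 ?_
  exact isPreconnected_connectedComponentIn.closure.subset_connectedComponentIn
    (subset_closure (mem_connectedComponentIn hp))
    (closure_minimal (connectedComponentIn_subset S p) hS)

variable {N : ℕ} [NeZero N] {E : EuclideanSpace ℝ (Fin N) → ℝ}
  {Ω : Set (EuclideanSpace ℝ (Fin N))} {μ M B η L : ℝ}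

/-- The gradient is an open map near index-one points, so its norm has no local maximum there. -/
theorem norm_gradient_lt_of_mem_interior (hE : ContDiff ℝ 3 E) (hL : 0 < L)
    (hΩ : ∀ x ∈ Ω, ‖gradient E x‖ ≤ L) {x : EuclideanSpace ℝ (Fin N)} (hx : x ∈ interior Ω)
    (hindex : HasIndexOne E x) : ‖gradient E x‖ < L := by
  have hstrict : HasStrictFDerivAt (gradient E) (hessian E x) x :=
    (contDiff_gradient hE).contDiffAt.hasStrictFDerivAt two_ne_zero
  have hinj : Function.Injective
      (hessian E x : EuclideanSpace ℝ (Fin N) →ₗ[ℝ] EuclideanSpace ℝ (Fin N)) :=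
    (injective_iff_map_eq_zero _).2 fun w hw => hindex.injective hw
  have hsurj := LinearMap.range_eq_top.2 (LinearMap.injective_iff_surjective.1 hinj)
  have hmap := hstrict.map_nhds_eq_of_surj hsurj
  have hball : Metric.closedBall (0 : EuclideanSpace ℝ (Fin N)) L ∈ 𝓝 (gradient E x) := by
    rw [← hmap, mem_map]
    filter_upwards [mem_interior_iff_mem_nhds.1 hx] with y hy
    simpa using hΩ y hy
  have := mem_interior_iff_mem_nhds.2 hball
  rw [interior_closedBall _ hL.ne'] at this
  simpa using this

/-- A lowest eigenvector at an index-one point realizes the spectral gap. -/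
theorem HasUniformBounds.hasGap (h : HasUniformBounds E Ω μ M B) {x u : EuclideanSpace ℝ (Fin N)}
    (hx : x ∈ Ω) (hu : IsLowestEigenvector E x u) :
    ∃ l, hessian E x u = l • u ∧ HasGap (hessian E x) μ u l := by
  obtain ⟨hu1, hH, hHu⟩ := hu
  obtain ⟨u', hH', hgap⟩ := h.gap x hx
  have huu : inner ℝ u u = 1 := by rw [real_inner_self_eq_norm_sq, hu1]; norm_num
  have hR : inner ℝ u (hessian E x u) = eig hH 0 := by
    rw [hHu, inner_smul_right, huu, mul_one]
  have hneg : eig hH 0 ≤ 0 := by linarith [hgap.le_neg, h.pos]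
  -- An exact eigenvector has zero residual, so u is a multiple of u' and both have the same
  -- orthogonal complement.
  have h1 := hgap.norm_sub_proj_le (v := u) (hR.trans_le hneg)
  rw [hR, hHu, sub_self, norm_zero] at h1
  have h2 : ‖u - inner ℝ u' u • u'‖ = 0 :=
    le_antisymm (nonpos_of_mul_nonpos_right h1 h.pos) (norm_nonneg _)
  have h3 : u = inner ℝ u' u • u' := sub_eq_zero.1 (norm_eq_zero.1 h2)
  refine ⟨eig hH 0, hHu, hgap.symm, hu1, hHu, hgap.le_neg, fun w hw => hgap.coercive w ?_⟩
  rw [h3, real_inner_smul_left] at hw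
  rcases mul_eq_zero.1 hw with h4 | h4
  · rw [h4, zero_smul] at h3
    rw [h3, norm_zero] at hu1
    exact absurd hu1 zero_ne_one
  · exact h4

/-- A unit vector with vanishing residual and nonpositive Rayleigh quotient is a lowest
eigenvector. -/
theorem HasUniformBounds.isLowestEigenvector (h : HasUniformBounds E Ω μ M B)
    {p : EuclideanSpace ℝ (Fin N) × EuclideanSpace ℝ (Fin N)} (hp : IsAligned E Ω 0 p) :
    IsLowestEigenvector E p.1 p.2 := by
  obtain ⟨u, hH, hgap⟩ := h.gap p.1 hp.mem
  have h1 := (hgap.norm_sub_proj_le hp.rayleigh_le).trans (hp.norm_residual_le le_rfl)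
  have h2 : ‖p.2 - inner ℝ u p.2 • u‖ = 0 :=
    le_antisymm (nonpos_of_mul_nonpos_right h1 h.pos) (norm_nonneg _)
  have h3 : p.2 = inner ℝ u p.2 • u := sub_eq_zero.1 (norm_eq_zero.1 h2)
  refine ⟨hp.norm_eq, hH, ?_⟩
  rw [h3, map_smul, hgap.eigen, smul_comm]

/-- A direction close to a lowest eigenvector is aligned. -/
theorem HasUniformBounds.isAligned_of_norm_sub_le (h : HasUniformBounds E Ω μ M B) {δ : ℝ}
    {x u v : EuclideanSpace ℝ (Fin N)} (hx : x ∈ Ω) (hu : IsLowestEigenvector E x u)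
    (hv : ‖v‖ = 1) (huv : ‖v - u‖ ≤ δ) (hη : 2 * M * δ ≤ η) (hημ : η ≤ μ) :
    IsAligned E Ω η (x, v) := by
  obtain ⟨l, hl, hgap⟩ := h.hasGap hx hu
  have hM := h.norm_hessian_le x hx
  have hM0 := h.M_nonneg
  have hlM : |l| ≤ M := by
    have h1 := (hessian E x).le_opNorm u
    rw [hl, norm_smul, hgap.norm_eq, Real.norm_eq_abs, mul_one, mul_one] at h1
    exact h1.trans hM
  have h1 : ‖hessian E x v - l • v‖ ≤ η := by
    have h2 : hessian E x v - l • v = hessian E x (v - u) - l • (v - u) := by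
      rw [map_sub, hl, smul_sub]; abel
    calc ‖hessian E x v - l • v‖ ≤ ‖hessian E x (v - u)‖ + ‖l • (v - u)‖ := by
          rw [h2]; exact norm_sub_le _ _
      _ ≤ M * ‖v - u‖ + M * ‖v - u‖ := by
          refine add_le_add (((hessian E x).le_opNorm _).trans (by gcongr)) ?_
          rw [norm_smul, Real.norm_eq_abs]
          gcongr
      _ ≤ η := by nlinarith
  refine ⟨hx, hv, ?_, ?_⟩
  · have := rayleigh_le (T := hessian E x) hv l
    change inner ℝ v (hessian E x v) ≤ 0
    linarith [hgap.le_neg]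
  · rw [← norm_residual_sq (p := (x, v)) hv]
    exact pow_le_pow_left₀ (norm_nonneg _)
      ((norm_residual_le (T := hessian E x) hv l).trans h1) 2

variable {z : ℝ → EuclideanSpace ℝ (Fin N) × EuclideanSpace ℝ (Fin N)} {k : ℝ}

/-- Aligned initial data in the interior yield a global aligned trajectory along which the
Lyapunov function decays exponentially. -/
theorem HasUniformBounds.exists_trajectory (h : HasUniformBounds E Ω μ M B)
    (hη : 0 ≤ η) (hη' : (M + μ) * η ^ 2 ≤ μ ^ 3 / 2) (hbdd : Bornology.IsBounded Ω)
    {p : EuclideanSpace ℝ (Fin N) × EuclideanSpace ℝ (Fin N)}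
    (hΩ : Ω = connectedComponentIn {x | ‖gradient E x‖ ≤ L} p.1) {a : ℝ} (ha : 0 < a)
    (hk : 1 / 2 + 2 * B ^ 2 / (a * μ ^ 2) ≤ k) (hpL : ‖gradient E p.1‖ < L)
    (hp : IsAligned E Ω η p) (hlyap : a * ‖gradient E p.1‖ ^ 2 + residualSq E p < η ^ 2) :
    ∃ z : ℝ → EuclideanSpace ℝ (Fin N) × EuclideanSpace ℝ (Fin N), z 0 = p ∧ ContDiff ℝ 1 z ∧
      ∀ t, 0 ≤ t → HasDerivAt z (gadField E k (z t)) t ∧ IsAligned E Ω η (z t) ∧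
        a * ‖gradient E (z t).1‖ ^ 2 + residualSq E (z t) ≤ η ^ 2 * Real.exp (-(μ / 2) * t) := by
  have hμ := h.pos
  obtain ⟨ρ, hρ⟩ := hbdd.exists_norm_le
  -- Aligned states have norm strictly below ρ', so the truncation is never felt.
  set ρ' := max ρ 1 + 1 with hρ'
  have hρ1 : 1 < ρ' := by have := le_max_right ρ 1; linarith
  have hnorm : ∀ q, IsAligned E Ω η q → ‖q‖ < ρ' := by
    intro q hq
    rw [Prod.norm_def]
    refine max_lt ?_ (hq.norm_eq ▸ hρ1)
    have := hρ _ hq.mem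
    have := le_max_left ρ 1
    linarith
  obtain ⟨z, hz0, hzC, hz⟩ := exists_global_truncated_curve (contDiff_gadField h.contDiff k)
    (zero_lt_one.trans hρ1) p
  have hzc := hzC.continuous
  have hFc : Continuous (gradient E) := (contDiff_gradient h.contDiff).continuous
  have hRc := continuous_rayleigh h.contDiff
  have hqc := continuous_residualSq h.contDiff
  have hnc : Continuous fun q : EuclideanSpace ℝ (Fin N) × EuclideanSpace ℝ (Fin N) =>
      ‖gradient E q.1‖ := (hFc.comp continuous_fst).norm
  -- Neither x ∈ Ω nor ‖v‖ = 1 is an open condition, so both are left out here and recovered along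
  -- the trajectory.
  set C := {q : EuclideanSpace ℝ (Fin N) × EuclideanSpace ℝ (Fin N) |
    (‖q‖ ≤ ρ' ∧ ‖gradient E q.1‖ ≤ L) ∧ residualSq E q ≤ η ^ 2 ∧ rayleigh E q ≤ 0} with hC
  set U := {q : EuclideanSpace ℝ (Fin N) × EuclideanSpace ℝ (Fin N) |
    (‖q‖ < ρ' ∧ ‖gradient E q.1‖ < L) ∧ residualSq E q < η ^ 2 ∧ rayleigh E q < 0} with hU
  have hCc : IsClosed C :=
    ((isClosed_le continuous_norm continuous_const).inter
      (isClosed_le hnc continuous_const)).inter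
    ((isClosed_le hqc continuous_const).inter (isClosed_le hRc continuous_const))
  have hUo : IsOpen U :=
    ((isOpen_lt continuous_norm continuous_const).inter
      (isOpen_lt hnc continuous_const)).inter
    ((isOpen_lt hqc continuous_const).inter (isOpen_lt hRc continuous_const))
  have hUC : U ⊆ C := fun q hq => ⟨⟨hq.1.1.le, hq.1.2.le⟩, hq.2.1.le, hq.2.2.le⟩
  have step : ∀ t, 0 ≤ t → (∀ s ∈ Icc 0 t, z s ∈ C) →
      (HasDerivAt z (gadField E k (z t)) t ∧ IsAligned E Ω η (z t) ∧
        a * ‖gradient E (z t).1‖ ^ 2 + residualSq E (z t) ≤ η ^ 2 * Real.exp (-(μ / 2) * t)) ∧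
      z t ∈ U := by
    intro t ht hs
    have hd : ∀ s ∈ Icc 0 t, HasDerivAt z (gadField E k (z s)) s :=
      fun s hst => hz s (hs s hst).1.1
    have hone := norm_snd_eq_one_of_hasDerivAt h.contDiff hzc hd (by rw [hz0, hp.norm_eq])
    have hmem : ∀ s ∈ Icc 0 t, (z s).1 ∈ Ω := by
      intro s hst
      have hpre : IsPreconnected ((fun s => (z s).1) '' Icc 0 t) :=
        isPreconnected_Icc.image _ (continuous_fst.comp hzc).continuousOn
      have hsub := hpre.subset_connectedComponentIn (x := p.1)
        (F := {x | ‖gradient E x‖ ≤ L}) ⟨0, ⟨le_rfl, ht⟩, by simp [hz0]⟩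
        (by rintro _ ⟨r, hr, rfl⟩; exact (hs r hr).1.2)
      rw [hΩ]
      exact hsub ⟨s, hst, rfl⟩
    have hal : ∀ s ∈ Icc 0 t, IsAligned E Ω η (z s) := fun s hst =>
      ⟨hmem s hst, hone s hst, (hs s hst).2.2, (hs s hst).2.1⟩
    have htt : t ∈ Icc 0 t := ⟨ht, le_rfl⟩
    have hF : ∀ s : Icc 0 t, ∃ d, HasDerivAt (fun s => ‖gradient E (z s).1‖ ^ 2) d s ∧
        d ≤ -μ * ‖gradient E (z s).1‖ ^ 2 := fun s =>
      h.exists_deriv_gradient hη hη' (hal s s.2) (hd s s.2)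
    have hΨ : ∀ s : Icc 0 t, ∃ d,
        HasDerivAt (fun s => a * ‖gradient E (z s).1‖ ^ 2 + residualSq E (z s)) d s ∧
        d ≤ -(μ / 2) * (a * ‖gradient E (z s).1‖ ^ 2 + residualSq E (z s)) := fun s =>
      h.exists_deriv_lyapunov hη hη' ha hk (hal s s.2) (hd s s.2)
    have hFle := le_mul_exp_of_deriv_le (f' := deriv fun s => ‖gradient E (z s).1‖ ^ 2) ht
      (fun s hst => by
        obtain ⟨d, hd1, -⟩ := hF ⟨s, hst⟩
        exact hd1.differentiableAt.hasDerivAt)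
      (fun s hst => by
        obtain ⟨d, hd1, hd2⟩ := hF ⟨s, hst⟩
        rw [hd1.deriv]; exact hd2)
    have hΨle := le_mul_exp_of_deriv_le
      (f' := deriv fun s => a * ‖gradient E (z s).1‖ ^ 2 + residualSq E (z s)) ht
      (fun s hst => by
        obtain ⟨d, hd1, -⟩ := hΨ ⟨s, hst⟩
        exact hd1.differentiableAt.hasDerivAt)
      (fun s hst => by
        obtain ⟨d, hd1, hd2⟩ := hΨ ⟨s, hst⟩
        rw [hd1.deriv]; exact hd2)
    have hexp : ∀ c : ℝ, 0 ≤ c → Real.exp (-c * t) ≤ 1 := fun c hc =>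
      Real.exp_le_one_iff.2 (by nlinarith)
    rw [hz0] at hFle hΨle
    have hΨlt : a * ‖gradient E (z t).1‖ ^ 2 + residualSq E (z t) ≤
        η ^ 2 * Real.exp (-(μ / 2) * t) :=
      hΨle.trans (mul_le_mul_of_nonneg_right hlyap.le (Real.exp_pos _).le)
    refine ⟨⟨hd t htt, hal t htt, hΨlt⟩, ⟨hnorm _ (hal t htt), ?_⟩, ?_, ?_⟩
    · have h1 : ‖gradient E (z t).1‖ ^ 2 ≤ ‖gradient E p.1‖ ^ 2 :=
        hFle.trans (mul_le_of_le_one_right (sq_nonneg _) (hexp μ hμ.le))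
      exact (le_of_sq_le_sq h1 (norm_nonneg _)).trans_lt hpL
    · have hq0 : 0 ≤ residualSq E p := norm_residual_sq (E := E) hp.norm_eq ▸ sq_nonneg _
      have h1 : (a * ‖gradient E p.1‖ ^ 2 + residualSq E p) * Real.exp (-(μ / 2) * t) ≤
          a * ‖gradient E p.1‖ ^ 2 + residualSq E p :=
        mul_le_of_le_one_right (by positivity) (hexp (μ / 2) (by positivity))
      have h2 : 0 ≤ a * ‖gradient E (z t).1‖ ^ 2 := by positivity
      linarith
    · have := (h.coercive hη hη' (hal t htt)).1
      linarith
  have hmemU : ∀ t, 0 ≤ t → z t ∈ U := fun t ht =>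
    mem_of_closed_open_bootstrap hzc hCc hUo hUC
      (by rw [hz0]; exact ⟨⟨(hnorm p hp).le, hpL.le⟩, hp.residualSq_le, hp.rayleigh_le⟩)
      (fun t ht hs => (step t ht hs).2) ht
  exact ⟨z, hz0, hzC, fun t ht => (step t ht fun s hs => hUC (hmemU s hs.1)).1⟩

/-- Along an aligned curve there is a continuous choice of the lowest eigenvector close to `v`. -/
theorem HasUniformBounds.exists_continuousOn_eigenvector (h : HasUniformBounds E Ω μ M B)
    (hη : 0 ≤ η) (hη' : η ≤ μ / 8) (hz : Continuous z)
    (hal : ∀ t, 0 ≤ t → IsAligned E Ω η (z t)) {u₀ : EuclideanSpace ℝ (Fin N)}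
    (hu₀ : IsLowestEigenvector E (z 0).1 u₀) (huv : 0 ≤ inner ℝ u₀ (z 0).2) :
    ∃ u : ℝ → EuclideanSpace ℝ (Fin N), ContinuousOn u (Ici 0) ∧ u 0 = u₀ ∧
      (∀ t, 0 ≤ t → IsLowestEigenvector E (z t).1 (u t)) ∧
      ∀ t, 0 ≤ t → ‖(z t).2 - u t‖ ≤
        2 / μ * ‖hessian E (z t).1 (z t).2 - rayleigh E (z t) • (z t).2‖ := by
  have hμ := h.pos
  -- At each time the sign is the one on the side of v; at time 0 it is the prescribed one.
  have hex : ∀ t, ∃ w, 0 ≤ t → IsLowestEigenvector E (z t).1 w ∧ 0 ≤ inner ℝ w (z t).2 ∧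
      (t = 0 → w = u₀) := by
    intro t
    by_cases ht0 : t = 0
    · subst ht0
      exact ⟨u₀, fun _ => ⟨hu₀, huv, fun _ => rfl⟩⟩
    by_cases ht : 0 ≤ t
    · obtain ⟨w, hH, hgap⟩ := h.gap _ (hal t ht).mem
      rcases le_total 0 (inner ℝ w (z t).2) with hw | hw
      · exact ⟨w, fun _ => ⟨⟨hgap.norm_eq, hH, hgap.eigen⟩, hw, fun h => absurd h ht0⟩⟩
      · refine ⟨-w, fun _ => ⟨⟨by rw [norm_neg, hgap.norm_eq], hH, ?_⟩, ?_,
          fun h => absurd h ht0⟩⟩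
        · rw [map_neg, hgap.eigen, smul_neg]
        · rw [inner_neg_left]; linarith
    · exact ⟨0, fun h => absurd h ht⟩
  choose u hu using hex
  have hclose : ∀ t, 0 ≤ t → ‖(z t).2 - u t‖ ≤
      2 / μ * ‖hessian E (z t).1 (z t).2 - rayleigh E (z t) • (z t).2‖ := by
    intro t ht
    obtain ⟨h1, h2, -⟩ := hu t ht
    obtain ⟨l, -, hgap⟩ := h.hasGap (hal t ht).mem h1
    exact hgap.norm_sub_le hμ (hal t ht).norm_eq (hal t ht).rayleigh_le h2
  have hquarter : ∀ t, 0 ≤ t → ‖(z t).2 - u t‖ ≤ 1 / 4 := by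
    intro t ht
    refine (hclose t ht).trans ?_
    have h1 := (hal t ht).norm_residual_le hη
    rw [div_mul_eq_mul_div, div_le_iff₀ hμ]
    linarith
  refine ⟨u, ?_, (hu 0 le_rfl).2.2 rfl, fun t ht => (hu t ht).1, hclose⟩
  intro t ht
  obtain ⟨l, -, hgap⟩ := h.hasGap (hal t ht).mem (hu t ht).1
  have hHc : Continuous fun s => ‖hessian E (z t).1 - hessian E (z s).1‖ :=
    (continuous_const.sub
      ((contDiff_hessian h.contDiff).continuous.comp (continuous_fst.comp hz))).norm
  have hvc : Continuous fun s => ‖(z s).2 - (z t).2‖ :=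
    ((continuous_snd.comp hz).sub continuous_const).norm
  have hH0 : Tendsto (fun s => ‖hessian E (z t).1 - hessian E (z s).1‖) (𝓝[Ici 0] t) (𝓝 0) := by
    have := (hHc.tendsto t).mono_left (nhdsWithin_le_nhds (s := Ici 0))
    simpa using this
  have hv0 : Tendsto (fun s => ‖(z s).2 - (z t).2‖) (𝓝[Ici 0] t) (𝓝 0) := by
    have := (hvc.tendsto t).mono_left (nhdsWithin_le_nhds (s := Ici 0))
    simpa using this
  -- u(s) is an approximate eigenvector of the Hessian at time t, with residual at most the change
  -- of the Hessian. The same-sign condition holds because ‖u(s) - u(t)‖ ≤ 1/4 + 1/2 + 1/4.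
  have hbound : ∀ᶠ s in 𝓝[Ici 0] t,
      ‖u s - u t‖ ≤ 2 / μ * ‖hessian E (z t).1 - hessian E (z s).1‖ := by
    filter_upwards [self_mem_nhdsWithin, hH0.eventually (gt_mem_nhds hμ),
      hv0.eventually (gt_mem_nhds (show (0 : ℝ) < 1 / 2 by norm_num))] with s hs hs1 hs2
    obtain ⟨l', hl', hgap'⟩ := h.hasGap (hal s hs).mem (hu s hs).1
    have hres : ‖hessian E (z t).1 (u s) - l' • u s‖ ≤
        ‖hessian E (z t).1 - hessian E (z s).1‖ := by
      rw [← hl', ← sub_apply]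
      refine (ContinuousLinearMap.le_opNorm _ _).trans ?_
      rw [hgap'.norm_eq, mul_one]
    have hR := rayleigh_le (T := hessian E (z t).1) hgap'.norm_eq l'
    have hnear : ‖u s - u t‖ ≤ 1 := by
      have h1 : u s - u t = -((z s).2 - u s) + ((z s).2 - (z t).2) + ((z t).2 - u t) := by abel
      have h2 := norm_add₃_le (a := -((z s).2 - u s)) (b := (z s).2 - (z t).2)
        (c := (z t).2 - u t)
      rw [norm_neg, ← h1] at h2
      linarith [hquarter s hs, hquarter t ht]
    have hinner : 0 ≤ inner ℝ (u t) (u s) := by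
      have h1 : ‖u s - u t‖ ^ 2 = 2 - 2 * inner ℝ (u t) (u s) := by
        rw [norm_sub_sq_real, hgap.norm_eq, hgap'.norm_eq, real_inner_comm]; ring
      nlinarith [norm_nonneg (u s - u t)]
    refine (hgap.norm_sub_le hμ hgap'.norm_eq (by linarith [hgap'.le_neg]) hinner).trans ?_
    exact mul_le_mul_of_nonneg_left
      ((norm_residual_le hgap'.norm_eq l').trans hres) (by positivity)
  have hlim := hH0.const_mul (2 / μ)
  rw [mul_zero] at hlim
  exact tendsto_iff_norm_sub_tendsto_zero.2 (squeeze_zero' (.of_forall fun _ => norm_nonneg _)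
    hbound hlim)

end SaddleSearch

/-! ### Choice of constants and passage to the limit -/

theorem mainTheorem2 (N : ℕ) [NeZero N] (E : EuclideanSpace ℝ (Fin N) → ℝ)
    (hE : ContDiff ℝ 3 E) (L : ℝ) (hL : 0 < L) (Ω : Set (EuclideanSpace ℝ (Fin N)))
    (hΩ : ∃ p ∈ {x | ‖gradient E x‖ ≤ L}, Ω = connectedComponentIn {x | ‖gradient E x‖ ≤ L} p)
    (hbdd : Bornology.IsBounded Ω)
    (hindex : ∀ x ∈ Ω, SaddleSearch.HasIndexOne E x) :
    ∃ ε₀ > 0, ∃ δ₀ > 0, ∀ ε : ℝ, 0 < ε → ε < ε₀ → ∀ δ : ℝ, 0 < δ → δ < δ₀ →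
      ∀ x₀ ∈ interior Ω, ∀ u₀ : EuclideanSpace ℝ (Fin N),
      SaddleSearch.IsLowestEigenvector E x₀ u₀ →
      ∀ v₀ : EuclideanSpace ℝ (Fin N), ‖v₀‖ = 1 → ‖v₀ - u₀‖ < δ →
      ∃ x v : ℝ → EuclideanSpace ℝ (Fin N),
        -- a global solution in `C¹([0, ∞); Ω × S₁)`
        SaddleSearch.IsGADSolution E ε x₀ v₀ x v ∧
        ContDiffOn ℝ 1 x (Ici 0) ∧ ContDiffOn ℝ 1 v (Ici 0) ∧
        (∀ t, 0 ≤ t → x t ∈ Ω ∧ ‖v t‖ = 1) ∧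
        -- which is unique
        (∀ y w : ℝ → EuclideanSpace ℝ (Fin N), SaddleSearch.IsGADSolution E ε x₀ v₀ y w →
          ∀ t, 0 ≤ t → y t = x t ∧ w t = v t) ∧
        -- and converges exponentially to `(xs, us)`, where `xs` is a saddle and `us = v₁(xs)`
        ∃ xs ∈ Ω, SaddleSearch.IsIndexOneSaddle E xs ∧
        ∃ us : EuclideanSpace ℝ (Fin N), SaddleSearch.IsLowestEigenvector E xs us ∧
          -- the sign of `us` is the one obtained from that of `u₀` by continuity along `x`
          (∃ u : ℝ → EuclideanSpace ℝ (Fin N), ContinuousOn u (Ici 0) ∧ u 0 = u₀ ∧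
            (∀ t, 0 ≤ t → SaddleSearch.IsLowestEigenvector E (x t) (u t)) ∧
            Tendsto u atTop (𝓝 us)) ∧
          ∃ K > 0, ∃ c > 0, ∀ t, 0 ≤ t →
            ‖x t - xs‖ + ‖v t - us‖ ≤ K * Real.exp (-c * t) := by
  open SaddleSearch in
  obtain ⟨p, hpS, hΩp⟩ := hΩ
  have hFc : Continuous (gradient E) := (contDiff_gradient hE).continuous
  have hS : IsClosed {x | ‖gradient E x‖ ≤ L} := isClosed_le hFc.norm continuous_const
  have hΩcl : IsClosed Ω := hΩp ▸ isClosed_connectedComponentIn hS hpS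
  have hΩL : ∀ x ∈ Ω, ‖gradient E x‖ ≤ L := fun x hx =>
    connectedComponentIn_subset {x | ‖gradient E x‖ ≤ L} p (hΩp ▸ hx)
  obtain ⟨μ, M, B, h⟩ := exists_hasUniformBounds hE
    (Metric.isCompact_of_isClosed_isBounded hΩcl hbdd)
    ⟨p, hΩp ▸ mem_connectedComponentIn hpS⟩ hindex
  have hμ := h.pos
  have hM := h.M_nonneg
  have hB := h.B_nonneg
  obtain ⟨η, hη, hη8, hηM⟩ : ∃ η, 0 < η ∧ η ≤ μ / 8 ∧ (M + μ) * η ^ 2 ≤ μ ^ 3 / 2 := by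
    refine ⟨min (μ / 8) (μ ^ 2 / (M + μ)), by positivity, min_le_left _ _, ?_⟩
    have h1 := min_le_left (μ / 8) (μ ^ 2 / (M + μ))
    have h2 := min_le_right (μ / 8) (μ ^ 2 / (M + μ))
    have h0 : 0 < min (μ / 8) (μ ^ 2 / (M + μ)) := by positivity
    set η := min (μ / 8) (μ ^ 2 / (M + μ))
    rw [le_div_iff₀ (by positivity)] at h2
    calc (M + μ) * η ^ 2 = η * (M + μ) * η := by ring
      _ ≤ μ ^ 2 * (μ / 8) := by gcongr
      _ ≤ μ ^ 3 / 2 := by nlinarith [pow_pos hμ 3]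
  -- The gradient then uses at most half of the Lyapunov budget η²; the choice of δ₀ below limits
  -- the initial residual to a quarter of it.
  set a := η ^ 2 / (2 * L ^ 2) with ha
  have ha0 : 0 < a := by positivity
  set k₀ := 1 / 2 + 2 * B ^ 2 / (a * μ ^ 2) with hk₀
  have hk₀0 : 0 < k₀ := by positivity
  -- The bound ε₀ makes ε⁻² ≥ k₀. In δ₀, the 1 forces ⟨u₀, v₀⟩ > 0 and the other term gives 2Mδ ≤
  -- η/2.
  refine ⟨√(k₀⁻¹), by positivity, min 1 (η / (4 * (M + 1))), by positivity, ?_⟩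
  intro ε hε hεlt δ hδ hδlt x₀ hx₀ u₀ hu₀ v₀ hv₀ hvu
  have hk : k₀ ≤ (ε ^ 2)⁻¹ := by
    rw [le_inv_comm₀ hk₀0 (by positivity)]
    exact ((Real.lt_sqrt hε.le).1 hεlt).le
  set k := (ε ^ 2)⁻¹ with hkdef
  have hk0 : 0 ≤ k := by positivity
  have hx₀Ω : x₀ ∈ Ω := interior_subset hx₀
  have hδη : 2 * M * δ ≤ η / 2 := by
    have h1 := hδlt.le.trans (min_le_right _ _)
    rw [le_div_iff₀ (by positivity)] at h1
    nlinarith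
  have hal₀ : IsAligned E Ω (η / 2) (x₀, v₀) :=
    h.isAligned_of_norm_sub_le hx₀Ω hu₀ hv₀ hvu.le hδη (by linarith)
  have hx₀L : ‖gradient E x₀‖ < L :=
    norm_gradient_lt_of_mem_interior hE hL hΩL hx₀ (hindex x₀ hx₀Ω)
  have hlyap : a * ‖gradient E x₀‖ ^ 2 + residualSq E (x₀, v₀) < η ^ 2 := by
    have h1 : a * ‖gradient E x₀‖ ^ 2 ≤ a * L ^ 2 := by gcongr
    have h2 : a * L ^ 2 = η ^ 2 / 2 := by rw [ha]; field_simp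
    have h3 := hal₀.residualSq_le
    nlinarith [pow_pos hη 2]
  have hal₀' : IsAligned E Ω η (x₀, v₀) :=
    ⟨hal₀.mem, hal₀.norm_eq, hal₀.rayleigh_le, hal₀.residualSq_le.trans (by nlinarith)⟩
  obtain ⟨z, hz0, hzC, hz⟩ := h.exists_trajectory (p := (x₀, v₀)) (L := L) hη.le hηM hbdd
    (by rw [hΩp] at hx₀Ω ⊢; exact connectedComponentIn_eq hx₀Ω) ha0 hk hx₀L hal₀' hlyap
  have hzc := hzC.continuous
  have hal : ∀ t, 0 ≤ t → IsAligned E Ω η (z t) := fun t ht => (hz t ht).2.1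
  have hexp : ∀ t, Real.exp (-(μ / 2) * t) = Real.exp (-(μ / 4) * t) ^ 2 := fun t => by
    rw [← Real.exp_nat_mul]; congr 1; push_cast; ring
  have hq0 : ∀ t, 0 ≤ t → 0 ≤ residualSq E (z t) := fun t ht =>
    norm_residual_sq (E := E) (hal t ht).norm_eq ▸ sq_nonneg _
  -- The decay gives the factor 2L²; it is relaxed to (2L)² to avoid a square root.
  have hgrad : ∀ t, 0 ≤ t → ‖gradient E (z t).1‖ ^ 2 ≤ (2 * L * Real.exp (-(μ / 4) * t)) ^ 2 := by
    intro t ht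
    have h1 := (hz t ht).2.2
    have h2 := hq0 t ht
    rw [hexp] at h1
    have h3 : a * ‖gradient E (z t).1‖ ^ 2 ≤ a * (2 * L * Real.exp (-(μ / 4) * t)) ^ 2 := by
      have h4 : a * (2 * L * Real.exp (-(μ / 4) * t)) ^ 2 =
          2 * (η ^ 2 * Real.exp (-(μ / 4) * t) ^ 2) := by rw [ha]; field_simp
      have h5 : 0 ≤ η ^ 2 * Real.exp (-(μ / 4) * t) ^ 2 := by positivity
      linarith
    exact le_of_mul_le_mul_left h3 ha0
  have hres : ∀ t, 0 ≤ t → residualSq E (z t) ≤ (η * Real.exp (-(μ / 4) * t)) ^ 2 := by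
    intro t ht
    have h1 := (hz t ht).2.2
    have h2 : 0 ≤ a * ‖gradient E (z t).1‖ ^ 2 := by positivity
    rw [hexp] at h1
    rw [mul_pow]
    linarith
  obtain ⟨q, hq⟩ := exists_limit_of_norm_deriv_le_exp (c := μ / 4) (K := 2 * L + k * η)
    (by positivity) (fun t ht => (hz t ht).1) (fun t ht => (hal t ht).norm_gadField_le hk0
      (by positivity) hη.le (Real.exp_pos _).le (hgrad t ht) (hres t ht))
  have hexp0 : Tendsto (fun t => Real.exp (-(μ / 4) * t)) atTop (𝓝 0) :=
    Real.tendsto_exp_atBot.comp (tendsto_id.const_mul_atTop_of_neg (by linarith))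
  have hzq : Tendsto z atTop (𝓝 q) := by
    refine tendsto_iff_norm_sub_tendsto_zero.2 (squeeze_zero' (.of_forall fun _ => norm_nonneg _)
      ((eventually_ge_atTop 0).mono hq) ?_)
    simpa using hexp0.const_mul ((2 * L + k * η) / (μ / 4))
  have hzq1 : Tendsto (fun t => (z t).1) atTop (𝓝 q.1) := (continuous_fst.tendsto q).comp hzq
  have hzq2 : Tendsto (fun t => (z t).2) atTop (𝓝 q.2) := (continuous_snd.tendsto q).comp hzq
  have hq1 : q.1 ∈ Ω :=
    hΩcl.mem_of_tendsto hzq1 ((eventually_ge_atTop 0).mono fun t ht => (hal t ht).mem)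
  have hres0 : Tendsto (fun t => (η * Real.exp (-(μ / 4) * t)) ^ 2) atTop (𝓝 0) := by
    simpa using (hexp0.const_mul η).pow 2
  -- Alignment is a closed condition and the residual tends to 0, so the limit direction is an exact
  -- eigenvector.
  have hqal : IsAligned E Ω 0 q := by
    refine ⟨hq1, ?_, ?_, ?_⟩
    · exact tendsto_nhds_unique hzq2.norm (tendsto_const_nhds.congr'
        ((eventually_ge_atTop 0).mono fun t ht => (hal t ht).norm_eq.symm))
    · exact le_of_tendsto (((continuous_rayleigh hE).tendsto q).comp hzq)
        ((eventually_ge_atTop 0).mono fun t ht => (hal t ht).rayleigh_le)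
    · rw [zero_pow two_ne_zero]
      exact le_of_tendsto_of_tendsto (((continuous_residualSq hE).tendsto q).comp hzq) hres0
        ((eventually_ge_atTop 0).mono hres)
  have hqgrad : gradient E q.1 = 0 := by
    have h1 : Tendsto (fun t => (2 * L * Real.exp (-(μ / 4) * t)) ^ 2) atTop (𝓝 0) := by
      simpa using (hexp0.const_mul (2 * L)).pow 2
    have h2 : Tendsto (fun t => ‖gradient E (z t).1‖ ^ 2) atTop (𝓝 (‖gradient E q.1‖ ^ 2)) :=
      (((hFc.tendsto q.1).comp hzq1).norm).pow 2
    have h3 : ‖gradient E q.1‖ ^ 2 ≤ 0 :=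
      le_of_tendsto_of_tendsto h2 h1 ((eventually_ge_atTop 0).mono hgrad)
    exact norm_eq_zero.1 (pow_eq_zero_iff two_ne_zero |>.1 (le_antisymm h3 (sq_nonneg _)))
  have hinner : 0 ≤ inner ℝ u₀ v₀ := by
    have h1 : ‖v₀ - u₀‖ ^ 2 = 2 - 2 * inner ℝ u₀ v₀ := by
      rw [norm_sub_sq_real, hv₀, hu₀.1, real_inner_comm]; ring
    have h2 : ‖v₀ - u₀‖ ≤ 1 := hvu.le.trans (hδlt.le.trans (min_le_left _ _))
    nlinarith [norm_nonneg (v₀ - u₀)]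
  obtain ⟨u, huc, hu0, huE, huv⟩ := h.exists_continuousOn_eigenvector hη.le hη8 hzc hal
    (u₀ := u₀) (by rw [hz0]; exact hu₀) (by rw [hz0]; exact hinner)
  have hulim : Tendsto u atTop (𝓝 q.2) := by
    have h1 : Tendsto (fun t => (z t).2 - u t) atTop (𝓝 0) := by
      refine squeeze_zero_norm' (a := fun t => 2 / μ * (η * Real.exp (-(μ / 4) * t))) ?_ ?_
      · filter_upwards [eventually_ge_atTop 0] with t ht
        refine (huv t ht).trans (mul_le_mul_of_nonneg_left ?_ (by positivity))
        exact le_of_sq_le_sq ((norm_residual_sq (hal t ht).norm_eq).trans_le (hres t ht))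
          (by positivity)
      · simpa using (hexp0.const_mul η).const_mul (2 / μ)
    simpa using hzq2.sub h1
  have hd1 : ∀ t, 0 ≤ t → HasDerivAt (fun t => (z t).1) (gadField E k (z t)).1 t :=
    fun t ht => (hz t ht).1.fst
  have hd2 : ∀ t, 0 ≤ t → HasDerivAt (fun t => (z t).2) (gadField E k (z t)).2 t :=
    fun t ht => (hz t ht).1.snd
  have hsol : IsGADSolution E ε x₀ v₀ (fun t => (z t).1) (fun t => (z t).2) :=
    { x_zero := by rw [hz0]
      v_zero := by rw [hz0]
      x_deriv := fun t ht => (hd1 t ht).hasDerivWithinAt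
      v_deriv := fun t ht => (hd2 t ht).hasDerivWithinAt }
  refine ⟨fun t => (z t).1, fun t => (z t).2, hsol, hzC.fst.contDiffOn, hzC.snd.contDiffOn,
    fun t ht => ⟨(hal t ht).mem, (hal t ht).norm_eq⟩, fun y w hyw t ht => ?_, q.1, hq1,
    ⟨hqgrad, hindex _ hq1⟩, q.2, h.isLowestEigenvector hqal, ⟨u, huc, hu0, huE, hulim⟩,
    2 * ((2 * L + k * η) / (μ / 4)), by positivity, μ / 4, by positivity, fun t ht => ?_⟩
  · have h1 := eq_of_hasDerivWithinAt_Ici (contDiff_gadField hE k) (y := fun t => (y t, w t))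
      (z := z) (fun t ht => hyw.hasDerivWithinAt ht) (fun t ht => (hz t ht).1.hasDerivWithinAt)
      (by rw [hz0, hyw.x_zero, hyw.v_zero]) ht
    exact ⟨congrArg Prod.fst h1, congrArg Prod.snd h1⟩
  · have h1 := hq t ht
    have h2 : ‖(z t).1 - q.1‖ ≤ ‖z t - q‖ := norm_fst_le (z t - q)
    have h3 : ‖(z t).2 - q.2‖ ≤ ‖z t - q‖ := norm_snd_le (z t - q)
    linarith
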